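/- Let $x_1, x_2, \dots$ be independent random variables with a common Gaussian distribution $N(m,v)$, $m\in\mathbb R$, $v>0$, and let $\mathcal T$ be a finite set of positive integers (lags). For $n$ larger than every element of $\mathcal T$ (and $n\ge 2$), let $\bar x_n=\frac1n\sum_{t=1}^n x_t$, let $s_n^2$ be the sample variance of $x_1,\dots,x_n$, with either of the usual divisors, i.e. $s_n^2=\frac1n\sum_{t=1}^n(x_t-\bar x_n)^2$ or $s_n^2=\frac1{n-1}\sum_{t=1}^n(x_t-\bar x_n)^2$, let $z_{t}=(x_t-\bar x_n)/s_n$ ($1\le t\le n$) be the standardized series, and set $$Q_n=n\sum_{\tau\in\mathcal T}\frac14\left(\frac1{n-\tau}\sum_{t=1}^{n-\tau}z_t^2z_{t+\tau}^2-1\right)^2 .$$ Then, as $n\to\infty$, $Q_n$ converges in distribution to the chi-squared distribution with $|\mathcal T|$ degrees of freedom, that is, to the law of the sum of the squares of $|\mathcal T|$ independent standard normal variables. -/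

import Mathlib

open MeasureTheory ProbabilityTheory Filter

/-- Sample mean of the first `n` terms `x 0, …, x (n - 1)` of a series. -/
noncomputable def sampleMean (n : ℕ) (x : ℕ → ℝ) : ℝ :=
  (∑ t ∈ Finset.range n, x t) / n

/-- Sample variance of the first `n` terms with divisor `n - d`: `d = 0` is the variance of the
empirical distribution, `d = 1` the unbiased sample variance. -/
noncomputable def sampleVar (d n : ℕ) (x : ℕ → ℝ) : ℝ :=
  (∑ t ∈ Finset.range n, (x t - sampleMean n x) ^ 2) / ((n : ℝ) - d)

/-- The series standardized to have sample mean zero and sample variance one over its first `n`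
terms. -/
noncomputable def standardized (d n : ℕ) (x : ℕ → ℝ) (t : ℕ) : ℝ :=
  (x t - sampleMean n x) / √(sampleVar d n x)

/-- The statistic for volatility clustering with set of lags `T`, computed from the `n` observations
`x 0, …, x (n - 1)` after standardization. It is meant for `n` larger than every lag in `T`. -/
noncomputable def volatilityStat (d : ℕ) (T : Finset ℕ) (n : ℕ) (x : ℕ → ℝ) : ℝ :=
  n * ∑ τ ∈ T,
    ((∑ t ∈ Finset.range (n - τ),
        standardized d n x t ^ 2 * standardized d n x (t + τ) ^ 2) / ((n : ℝ) - τ) - 1) ^ 2 / 4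

/-- The chi-squared distribution with `k` degrees of freedom: the law of the sum of the squares of
`k` independent standard normal variables. -/
noncomputable def chiSquared (k : ℕ) : Measure ℝ :=
  (Measure.pi fun _ : Fin k => gaussianReal 0 1).map fun z => ∑ i, z i ^ 2

instance isProbabilityMeasure_chiSquared (k : ℕ) : IsProbabilityMeasure (chiSquared k) :=
  Measure.isProbabilityMeasure_map (Measurable.aemeasurable (by fun_prop))

/-! ### Central limit theorem for finite-range dependent martingale differences. -/

section DependentCLT

/-! Standardization removes location and scale, so the observations may be taken to be standard
normals `y t`. Put u_t = y_t² - 1, which has mean 0 and variance 2.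

Estimating the mean and the variance does not affect the limit. With r = n^(-1/2), let rY be the
sample mean, U = r ∑ u_t, and c = 1 + rU - r²Y² the variance with divisor n. Expanding the lagged
moment of the squared deviations about c², the contributions of U to the two cancel at order r.
Hence √n times the difference is r ∑ u_t u_{t+τ} plus terms that vanish in probability
(`lagged_moment_expansion`, `isNegligibleInProb_lagged_moment`). Every sum in the expansion has
orthogonal terms, so Chebyshev's inequality bounds it. Dividing by the squared variance, which tends
to 1, is harmless (`isNegligibleInProb_standardized_moment`).

It remains to show that the vector of the r ∑ u_t u_{t+τ} / 2 is asymptotically standard normal.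
Index the products for all lags by their later factor. A linear combination of them is then a
martingale difference D_k, because that factor is centred and independent of the past, and its
variance is 4 ∑ a_i², because the lags are distinct. The conditional variance of D_k is random, but
D_k is independent of the partial sum stopped M steps earlier. So the characteristic function φ_k of
r times the k-th partial sum satisfies φ_{k+1} = (1 - σ²r²/2) φ_k + O(r³), and n steps accumulate an
error O(r) (`tendsto_integral_exp_inv_sqrt_mul_sum`). Lévy's theorem, the continuous map v ↦ ∑ v_i²
and Slutsky's theorem finish the proof. -/

lemma tendsto_inv_sqrt_natCast : Tendsto (fun n : ℕ => (√(n : ℝ))⁻¹) atTop (nhds 0) :=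
  tendsto_inv_atTop_zero.comp (Real.tendsto_sqrt_atTop.comp tendsto_natCast_atTop_atTop)

lemma norm_exp_I_mul_ofReal (b : ℝ) : ‖Complex.exp (Complex.I * b)‖ = 1 := by
  rw [mul_comm]; exact Complex.norm_exp_ofReal_mul_I b

/-- Second-order Taylor estimate for `exp (i b)`. -/
lemma norm_exp_I_mul_sub_taylor_two_le (b : ℝ) :
    ‖Complex.exp (Complex.I * b) - (1 + Complex.I * b - (b : ℂ) ^ 2 / 2)‖ ≤ 4 * |b| ^ 3 := by
  have hI : ‖Complex.I * (b : ℂ)‖ = |b| := by simp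
  rcases le_or_gt |b| 1 with hb | hb
  · have h := Complex.exp_bound (x := Complex.I * b) (by rw [hI]; exact hb) (n := 3) (by norm_num)
    have hs : ∑ m ∈ Finset.range 3, (Complex.I * (b : ℂ)) ^ m / (m.factorial : ℂ)
        = 1 + Complex.I * b - (b : ℂ) ^ 2 / 2 := by
      simp [Finset.sum_range_succ, mul_pow, Nat.factorial]
      ring
    rw [hs, hI] at h
    refine h.trans ?_
    have : (0 : ℝ) ≤ |b| ^ 3 := by positivity
    norm_num [Nat.factorial]
    nlinarith
  -- The constant 4 comes from this case, where the terms add up to at most (1 + 1 + 1 + 1/2)|b|³.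
  · have h2 : ‖1 + Complex.I * b - (b : ℂ) ^ 2 / 2‖ ≤ 1 + |b| + |b| ^ 2 / 2 := by
      refine (norm_sub_le _ _).trans (add_le_add ((norm_add_le _ _).trans ?_) ?_)
      · simp
      · simp
    refine (norm_sub_le _ _).trans ?_
    rw [norm_exp_I_mul_ofReal]
    have : |b| ≤ |b| ^ 3 := by
      nlinarith [sq_nonneg |b|,
        mul_pos (by linarith : 0 < |b|) (by linarith : 0 < |b|)]
    have : |b| ^ 2 ≤ |b| ^ 3 := by nlinarith [sq_nonneg |b|]
    nlinarith

/-- A sequence that nearly satisfies a contracting linear recursion is close to its solution. -/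
lemma norm_sub_pow_mul_le_of_recursion {A : ℕ → ℂ} {ρ : ℂ} {δ : ℝ} (hρ : ‖ρ‖ ≤ 1)
    (h : ∀ k, ‖A (k + 1) - ρ * A k‖ ≤ δ) (n : ℕ) : ‖A n - ρ ^ n * A 0‖ ≤ n * δ := by
  induction n with
  | zero => simp
  | succ n ih =>
    have : A (n + 1) - ρ ^ (n + 1) * A 0 = (A (n + 1) - ρ * A n) + ρ * (A n - ρ ^ n * A 0) := by
      ring
    rw [this]
    calc _ ≤ ‖A (n + 1) - ρ * A n‖ + ‖ρ * (A n - ρ ^ n * A 0)‖ := norm_add_le _ _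
      _ ≤ δ + 1 * (n * δ) := by
        rw [norm_mul]
        gcongr
        exact h n
      _ = _ := by push_cast; ring

variable {Ω : Type*} [MeasurableSpace Ω] {P : Measure Ω} [IsProbabilityMeasure P]

lemma integrable_norm_pow_of_cube {D : Ω → ℝ} (hm : AEMeasurable D P)
    (h3 : Integrable (fun ω => |D ω| ^ 3) P) {j : ℕ} (hj : j ≤ 3) :
    Integrable (fun ω => |D ω| ^ j) P := by
  refine ((integrable_const (1 : ℝ)).add h3).mono' (by fun_prop) (ae_of_all _ fun ω => ?_)
  simp only [Pi.add_apply, norm_pow, Real.norm_eq_abs, abs_abs]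
  rcases le_total |D ω| 1 with h | h
  · have : |D ω| ^ j ≤ 1 := pow_le_one₀ (abs_nonneg _) h
    have : 0 ≤ |D ω| ^ 3 := by positivity
    linarith
  · have : |D ω| ^ j ≤ |D ω| ^ 3 := pow_le_pow_right₀ h hj
    linarith

/-- Allows mixed moments of two different increments to be controlled by third moments alone. -/
lemma sq_mul_le_cube_add_cube {a b : ℝ} (ha : 0 ≤ a) (hb : 0 ≤ b) : a ^ 2 * b ≤ a ^ 3 + b ^ 3 := by
  rcases le_total a b with h | h
  · nlinarith [mul_nonneg ha hb, pow_nonneg ha 3, mul_nonneg (sub_nonneg.2 h) hb,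
      mul_nonneg (mul_nonneg (sub_nonneg.2 h) hb) (add_nonneg ha hb)]
  · nlinarith [mul_nonneg (sq_nonneg a) (sub_nonneg.2 h), pow_nonneg hb 3]

variable {D : ℕ → Ω → ℝ} {M : ℕ} {σ2 C : ℝ}

/-- One step of the recursion for the characteristic function of the partial sums of a
finite-range dependent martingale difference sequence. -/
lemma norm_integral_exp_sum_succ_sub_le (hm : ∀ k, AEMeasurable (D k) P)
    (h3 : ∀ k, Integrable (fun ω => |D k ω| ^ 3) P) (hC : ∀ k, ∫ ω, |D k ω| ^ 3 ∂P ≤ C)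
    (hσ : 0 ≤ σ2)
    (h1 : ∀ k (s : ℝ), ∫ ω, Complex.exp (Complex.I * (s * ∑ t ∈ Finset.range k, D t ω : ℝ))
      * (D k ω : ℂ) ∂P = 0)
    (h2 : ∀ k (s : ℝ), ∫ ω, Complex.exp (Complex.I * (s * ∑ t ∈ Finset.range (k - M), D t ω : ℝ))
      * (D k ω : ℂ) ^ 2 ∂P = σ2 * ∫ ω, Complex.exp (Complex.I *
        (s * ∑ t ∈ Finset.range (k - M), D t ω : ℝ)) ∂P)
    {r : ℝ} (hr : 0 ≤ r) (k : ℕ) :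
    ‖∫ ω, Complex.exp (Complex.I * (r * ∑ t ∈ Finset.range (k + 1), D t ω : ℝ)) ∂P
      - (1 - σ2 * r ^ 2 / 2 : ℝ) *
        ∫ ω, Complex.exp (Complex.I * (r * ∑ t ∈ Finset.range k, D t ω : ℝ)) ∂P‖
      ≤ (4 * C + M * C + σ2 * M * (1 + C)) * r ^ 3 := by
  set E : ℕ → Ω → ℂ := fun k ω =>
    Complex.exp (Complex.I * (r * ∑ t ∈ Finset.range k, D t ω : ℝ)) with hE
  have hEm : ∀ k, AEStronglyMeasurable (E k) P := fun k => by
    have : AEMeasurable (E k) P := by fun_prop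
    exact this.aestronglyMeasurable
  have hEn : ∀ k ω, ‖E k ω‖ = 1 := fun k ω => norm_exp_I_mul_ofReal _
  have hsucc : ∀ ω, E (k + 1) ω = E k ω * Complex.exp (Complex.I * (r * D k ω : ℝ)) := fun ω => by
    simp only [hE]
    rw [← Complex.exp_add, Finset.sum_range_succ]
    push_cast
    ring_nf
  -- Dropping the last M increments costs only O(r). For k < M the truncated `k - M` is 0 and all
  -- increments are dropped.
  have hlag : ∀ ω, ‖E k ω - E (k - M) ω‖ ≤ r * ∑ t ∈ Finset.Ico (k - M) k, |D t ω| := fun ω => by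
    have hsum : ∑ t ∈ Finset.range k, D t ω
        = ∑ t ∈ Finset.range (k - M), D t ω + ∑ t ∈ Finset.Ico (k - M) k, D t ω :=
      (Finset.sum_range_add_sum_Ico _ (Nat.sub_le k M)).symm
    have : E k ω - E (k - M) ω = E (k - M) ω * (Complex.exp (Complex.I *
        (r * ∑ t ∈ Finset.Ico (k - M) k, D t ω : ℝ)) - 1) := by
      simp only [hE]
      rw [mul_sub, ← Complex.exp_add, hsum]
      push_cast
      ring_nf
    rw [this, norm_mul, hEn, one_mul]
    refine Real.norm_exp_I_mul_ofReal_sub_one_le.trans ?_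
    rw [norm_mul, Real.norm_of_nonneg hr]
    gcongr
    exact norm_sum_le _ _
  have h1' : ∫ ω, E k ω * (D k ω : ℂ) ∂P = 0 := h1 k r
  have h2' : ∫ ω, E (k - M) ω * (D k ω : ℂ) ^ 2 ∂P = σ2 * ∫ ω, E (k - M) ω ∂P := h2 k r
  change ‖∫ ω, E (k + 1) ω ∂P - (1 - σ2 * r ^ 2 / 2 : ℝ) * ∫ ω, E k ω ∂P‖ ≤ _
  clear_value E
  clear h1 h2 hE
  have hC0 : 0 ≤ C := (integral_nonneg fun ω => by positivity).trans (hC 0)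
  have hEi : ∀ k, Integrable (E k) P := fun k =>
    (integrable_const (1 : ℝ)).mono' (hEm k) (ae_of_all _ fun ω => (hEn k ω).le)
  have hDi : ∀ k, Integrable (fun ω => (D k ω : ℂ)) P := fun k =>
    (integrable_norm_pow_of_cube (hm k) (h3 k) (j := 1) (by norm_num)).mono' (by fun_prop)
      (ae_of_all _ fun ω => by simp)
  have hD2i : ∀ k, Integrable (fun ω => (D k ω : ℂ) ^ 2) P := fun k =>
    (integrable_norm_pow_of_cube (hm k) (h3 k) (j := 2) (by norm_num)).mono' (by fun_prop)
      (ae_of_all _ fun ω => by simp)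
  have hEDi : ∀ j k, Integrable (fun ω => E j ω * (D k ω : ℂ)) P := fun j k =>
    (hDi k).bdd_mul (hEm j) (ae_of_all _ fun ω => (hEn j ω).le)
  have hED2i : ∀ j k, Integrable (fun ω => E j ω * (D k ω : ℂ) ^ 2) P := fun j k =>
    (hD2i k).bdd_mul (hEm j) (ae_of_all _ fun ω => (hEn j ω).le)
  have hDabs : ∀ k, ∫ ω, |D k ω| ∂P ≤ 1 + C := fun k => by
    have : ∫ ω, |D k ω| ∂P ≤ ∫ ω, (1 + |D k ω| ^ 3) ∂P := by
      refine integral_mono_of_nonneg (ae_of_all _ fun ω => abs_nonneg _)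
        ((integrable_const _).add (h3 k)) (ae_of_all _ fun ω => ?_)
      have := abs_nonneg (D k ω)
      simp only
      nlinarith [sq_nonneg (|D k ω| - 1), sq_nonneg (|D k ω|),
        mul_nonneg this (sq_nonneg (|D k ω| - 1))]
    refine this.trans ?_
    rw [integral_add (integrable_const _) (h3 k)]
    simpa using hC k
  have hcard : ((Finset.Ico (k - M) k).card : ℝ) ≤ M := by
    rw [Nat.card_Ico]; exact_mod_cast (by omega)
  have hlagInt : ‖∫ ω, E k ω ∂P - ∫ ω, E (k - M) ω ∂P‖ ≤ r * (M * (1 + C)) := by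
    rw [← integral_sub (hEi _) (hEi _)]
    have hDi' : ∀ t, Integrable (fun ω => |D t ω|) P := fun t => by
      simpa using integrable_norm_pow_of_cube (hm t) (h3 t) (j := 1) (by norm_num)
    refine (norm_integral_le_of_norm_le
      ((integrable_finsetSum _ fun t _ => hDi' t).const_mul r) (ae_of_all _ hlag)).trans ?_
    rw [integral_const_mul, integral_finsetSum _ fun t _ => hDi' t]
    gcongr
    calc _ ≤ ∑ t ∈ Finset.Ico (k - M) k, (1 + C) := Finset.sum_le_sum fun t _ => hDabs t
      _ ≤ _ := by
        rw [Finset.sum_const, nsmul_eq_mul]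
        gcongr
  have hlagInt2 : ‖∫ ω, E k ω * (D k ω : ℂ) ^ 2 ∂P - ∫ ω, E (k - M) ω * (D k ω : ℂ) ^ 2 ∂P‖
      ≤ r * (M * (2 * C)) := by
    rw [← integral_sub (hED2i _ _) (hED2i _ _)]
    have hi : ∀ t, Integrable (fun ω => |D k ω| ^ 3 + |D t ω| ^ 3) P := fun t => (h3 k).add (h3 t)
    have hs : Integrable (fun ω => r * ∑ t ∈ Finset.Ico (k - M) k,
        (|D k ω| ^ 3 + |D t ω| ^ 3)) P := (integrable_finsetSum _ fun t _ => hi t).const_mul r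
    refine (norm_integral_le_of_norm_le (g := fun ω => r * ∑ t ∈ Finset.Ico (k - M) k,
      (|D k ω| ^ 3 + |D t ω| ^ 3))
      hs (ae_of_all _ fun ω => ?_)).trans ?_
    · rw [← sub_mul, norm_mul]
      calc _ ≤ (r * ∑ t ∈ Finset.Ico (k - M) k, |D t ω|) * |D k ω| ^ 2 := by
            gcongr
            · exact hlag ω
            · simp
        _ = r * ∑ t ∈ Finset.Ico (k - M) k, |D k ω| ^ 2 * |D t ω| := by
            rw [mul_assoc, Finset.sum_mul]; simp_rw [mul_comm]
        _ ≤ _ := by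
            gcongr
            exact sq_mul_le_cube_add_cube (abs_nonneg _) (abs_nonneg _)
    · rw [integral_const_mul, integral_finsetSum _ fun t _ => hi t]
      gcongr
      calc _ ≤ ∑ t ∈ Finset.Ico (k - M) k, (2 * C) := Finset.sum_le_sum fun t _ => by
            rw [integral_add (h3 k) (h3 t)]
            linarith [hC k, hC t]
        _ ≤ _ := by
          rw [Finset.sum_const, nsmul_eq_mul]
          gcongr
  -- Taylor expansion of the last factor. The linear term is then removed by the martingale property
  -- `h1'`.
  have hstep : ‖∫ ω, E (k + 1) ω ∂P - (∫ ω, E k ω ∂P + Complex.I * r * ∫ ω, E k ω * (D k ω : ℂ) ∂P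
      - (r : ℂ) ^ 2 / 2 * ∫ ω, E k ω * (D k ω : ℂ) ^ 2 ∂P)‖ ≤ 4 * C * r ^ 3 := by
    have i1 : Integrable (fun ω => Complex.I * r * (E k ω * (D k ω : ℂ))) P :=
      (hEDi k k).const_mul _
    have i2 : Integrable (fun ω => (r : ℂ) ^ 2 / 2 * (E k ω * (D k ω : ℂ) ^ 2)) P :=
      (hED2i k k).const_mul _
    have i3 : Integrable (fun ω => E k ω + Complex.I * r * (E k ω * (D k ω : ℂ))) P :=
      (hEi k).add i1
    have i4 : Integrable (fun ω => E k ω + Complex.I * r * (E k ω * (D k ω : ℂ))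
      - (r : ℂ) ^ 2 / 2 * (E k ω * (D k ω : ℂ) ^ 2)) P := i3.sub i2
    rw [← integral_const_mul, ← integral_const_mul, ← integral_add (hEi k) i1,
      ← integral_sub i3 i2, ← integral_sub (hEi _) i4]
    refine (norm_integral_le_of_norm_le (g := fun ω => 4 * r ^ 3 * |D k ω| ^ 3)
      ((h3 k).const_mul _) (ae_of_all _ fun ω => ?_)).trans ?_
    · have : E (k + 1) ω - (E k ω + Complex.I * r * (E k ω * (D k ω : ℂ))
          - (r : ℂ) ^ 2 / 2 * (E k ω * (D k ω : ℂ) ^ 2)) =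
          E k ω * (Complex.exp (Complex.I * (r * D k ω : ℝ)) -
            (1 + Complex.I * (r * D k ω : ℝ) - ((r * D k ω : ℝ) : ℂ) ^ 2 / 2)) := by
        rw [mul_sub]
        rw [hsucc]
        push_cast
        ring
      rw [this, norm_mul, hEn, one_mul]
      refine (norm_exp_I_mul_sub_taylor_two_le _).trans (le_of_eq ?_)
      rw [abs_mul, abs_of_nonneg hr]
      ring
    · rw [integral_const_mul]
      have : 0 ≤ 4 * r ^ 3 := by positivity
      nlinarith [hC k]
  rw [h1', mul_zero, add_zero] at hstep
  rw [h2'] at hlagInt2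
  -- Three errors: the Taylor remainder, the delay by M that decouples the past from D_k², and the
  -- undoing of that delay once the variance has been factored out.
  have hdecomp : ∫ ω, E (k + 1) ω ∂P - (1 - σ2 * r ^ 2 / 2 : ℝ) * ∫ ω, E k ω ∂P
      = (∫ ω, E (k + 1) ω ∂P - (∫ ω, E k ω ∂P
        - (r : ℂ) ^ 2 / 2 * ∫ ω, E k ω * (D k ω : ℂ) ^ 2 ∂P))
      + (-((r ^ 2 / 2 : ℝ) : ℂ)) * (∫ ω, E k ω * (D k ω : ℂ) ^ 2 ∂P
          - σ2 * ∫ ω, E (k - M) ω ∂P)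
      + ((σ2 * r ^ 2 / 2 : ℝ) : ℂ) * (∫ ω, E k ω ∂P - ∫ ω, E (k - M) ω ∂P) := by
    push_cast
    ring
  rw [hdecomp]
  have e1 : ‖(-((r ^ 2 / 2 : ℝ) : ℂ))‖ = r ^ 2 / 2 := by
    rw [norm_neg, Complex.norm_real, Real.norm_of_nonneg (by positivity)]
  have e2 : ‖((σ2 * r ^ 2 / 2 : ℝ) : ℂ)‖ = σ2 * r ^ 2 / 2 := by
    rw [Complex.norm_real, Real.norm_of_nonneg (by positivity)]
  calc _ ≤ 4 * C * r ^ 3 + r ^ 2 / 2 * (r * (M * (2 * C))) +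
        σ2 * r ^ 2 / 2 * (r * (M * (1 + C))) := by
        refine norm_add₃_le.trans ?_
        rw [norm_mul, norm_mul, e1, e2]
        gcongr
    _ ≤ _ := by
        have : 0 ≤ σ2 * M * (1 + C) * r ^ 3 := by positivity
        nlinarith

/-- Central limit theorem, in terms of characteristic functions, for a finite-range dependent
martingale difference sequence. -/
theorem tendsto_integral_exp_inv_sqrt_mul_sum (hm : ∀ k, AEMeasurable (D k) P)
    (h3 : ∀ k, Integrable (fun ω => |D k ω| ^ 3) P) (hC : ∀ k, ∫ ω, |D k ω| ^ 3 ∂P ≤ C)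
    (hσ : 0 ≤ σ2)
    (h1 : ∀ k (s : ℝ), ∫ ω, Complex.exp (Complex.I * (s * ∑ t ∈ Finset.range k, D t ω : ℝ))
      * (D k ω : ℂ) ∂P = 0)
    (h2 : ∀ k (s : ℝ), ∫ ω, Complex.exp (Complex.I * (s * ∑ t ∈ Finset.range (k - M), D t ω : ℝ))
      * (D k ω : ℂ) ^ 2 ∂P = σ2 * ∫ ω, Complex.exp (Complex.I *
        (s * ∑ t ∈ Finset.range (k - M), D t ω : ℝ)) ∂P) :
    Tendsto (fun n : ℕ => ∫ ω, Complex.exp (Complex.I *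
      ((√n)⁻¹ * ∑ t ∈ Finset.range n, D t ω : ℝ)) ∂P) atTop (nhds (Real.exp (-σ2 / 2) : ℝ)) := by
  set K : ℝ := 4 * C + M * C + σ2 * M * (1 + C)
  have hpow : Tendsto (fun n : ℕ => (((1 + (-σ2 / 2) / n) ^ n : ℝ) : ℂ)) atTop
      (nhds (Real.exp (-σ2 / 2) : ℝ)) :=
    (Complex.continuous_ofReal.tendsto _).comp (Real.tendsto_one_add_div_pow_exp (-σ2 / 2))
  rw [← sub_zero ((Real.exp (-σ2 / 2) : ℝ) : ℂ)]
  refine (hpow.sub (f := fun n : ℕ => (((1 + (-σ2 / 2) / n) ^ n : ℝ) : ℂ))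
    (g := fun n : ℕ => (((1 + (-σ2 / 2) / n) ^ n : ℝ) : ℂ) - ∫ ω, Complex.exp (Complex.I *
      ((√n)⁻¹ * ∑ t ∈ Finset.range n, D t ω : ℝ)) ∂P) ?_).congr (fun n => by ring)
  refine squeeze_zero_norm' (a := fun n : ℕ => K * (√(n : ℝ))⁻¹) ?_
    (by simpa using tendsto_inv_sqrt_natCast.const_mul K)
  -- The threshold gives n ≥ 1 and σ2 ≤ n, so that the multiplier 1 - σ2/(2n) has modulus at most 1.
  filter_upwards [eventually_ge_atTop (⌈σ2⌉₊ + 1)] with n hn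
  have hn1 : (1 : ℝ) ≤ n := by exact_mod_cast (by omega)
  have hnσ : σ2 ≤ n := (Nat.le_ceil σ2).trans (by exact_mod_cast (by omega))
  have hrn : ((√(n : ℝ))⁻¹) ^ 2 = (n : ℝ)⁻¹ := by
    rw [inv_pow, Real.sq_sqrt (by positivity)]
  have key := norm_sub_pow_mul_le_of_recursion (A := fun k => ∫ ω, Complex.exp (Complex.I *
      ((√(n : ℝ))⁻¹ * ∑ t ∈ Finset.range k, D t ω : ℝ)) ∂P)
    (ρ := ((1 - σ2 * (√(n : ℝ))⁻¹ ^ 2 / 2 : ℝ) : ℂ))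
    (δ := K * (√(n : ℝ))⁻¹ ^ 3) ?_
    (fun k => norm_integral_exp_sum_succ_sub_le hm h3 hC hσ h1 h2
      (r := (√(n : ℝ))⁻¹) (by positivity) k) n
  · have hρ : (1 - σ2 * (√(n : ℝ))⁻¹ ^ 2 / 2 : ℝ) = 1 + (-σ2 / 2) / n := by
      rw [hrn]; field_simp; ring
    rw [hρ] at key
    rw [norm_sub_rev]
    have e0 : ∫ ω, Complex.exp (Complex.I * ((√(n : ℝ))⁻¹ * ∑ t ∈ Finset.range 0, D t ω : ℝ)) ∂P
        = 1 := by simp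
    rw [e0, mul_one] at key
    rw [Complex.ofReal_pow]
    refine key.trans (le_of_eq ?_)
    rw [pow_succ ((√(n : ℝ))⁻¹) 2, hrn]
    field_simp
  · rw [Complex.norm_real, Real.norm_eq_abs, hrn, abs_le]
    have : σ2 * (n : ℝ)⁻¹ ≤ 1 := by
      rw [← div_eq_mul_inv]; exact (div_le_one (by linarith)).2 hnσ
    have : 0 ≤ σ2 * (n : ℝ)⁻¹ := by positivity
    constructor <;> linarith

end DependentCLT

/-! ### Moments of the standard normal law and of its centred square. -/

section GaussianMoments

lemma integrable_polynomial_gaussianReal (p : Polynomial ℝ) :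
    Integrable (fun x => p.eval x) (gaussianReal 0 1) := by
  have hpow : ∀ k : ℕ, Integrable (fun x : ℝ => x ^ k) (gaussianReal 0 1) := fun k => by
    have h := (memLp_id_gaussianReal' (μ := 0) (v := 1) k (by simp)).integrable_norm_pow'
    exact h.mono' (by fun_prop) (ae_of_all _ fun x => by simp)
  simp_rw [Polynomial.eval_eq_sum_range]
  exact integrable_finsetSum _ fun i _ => (hpow i).const_mul _

lemma integrable_pow_gaussianReal (k : ℕ) :
    Integrable (fun x : ℝ => x ^ k) (gaussianReal 0 1) := by
  simpa using integrable_polynomial_gaussianReal (Polynomial.X ^ k)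

lemma integral_sq_gaussianReal : ∫ x, x ^ 2 ∂(gaussianReal 0 1) = 1 := by
  have h := variance_fun_id_gaussianReal (μ := 0) (v := 1)
  rw [variance_eq_integral measurable_id'.aemeasurable] at h
  simpa using h

/-- Differentiating the moment generating function repeatedly reduces to the recursion p ↦ p' + tp
on polynomial factors. -/
lemma deriv_mul_exp_sq_half {p p' : ℝ → ℝ} (hp : ∀ t, HasDerivAt p (p' t) t) :
    deriv (fun t => p t * Real.exp (t ^ 2 / 2))
      = fun t => (p' t + p t * t) * Real.exp (t ^ 2 / 2) := by
  ext t
  have h1 : HasDerivAt (fun t : ℝ => t ^ 2 / 2) t t := by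
    convert! ((hasDerivAt_id t).pow 2).div_const 2 using 1
    simp
  have h2 : HasDerivAt (fun t => p t * Real.exp (t ^ 2 / 2)) _ t := (hp t).mul h1.exp
  rw [h2.deriv]
  ring

lemma integral_pow_four_gaussianReal : ∫ x, x ^ 4 ∂(gaussianReal 0 1) = 3 := by
  have h := iteratedDeriv_mgf_zero (X := fun x : ℝ => x) (μ := gaussianReal 0 1) (by simp) 4
  simp only [Pi.pow_apply] at h
  rw [← h, mgf_fun_id_gaussianReal]
  have h0 : (fun t : ℝ => Real.exp (0 * t + ((1 : NNReal) : ℝ) * t ^ 2 / 2))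
      = fun t => 1 * Real.exp (t ^ 2 / 2) := by
    ext t; simp
  -- Each `p` is kept in the unreduced form produced by the preceding step, so that the next rewrite
  -- matches syntactically.
  rw [h0, iteratedDeriv_succ, iteratedDeriv_succ, iteratedDeriv_succ, iteratedDeriv_one,
    deriv_mul_exp_sq_half (p := fun _ => 1) (p' := fun _ => 0) (fun t => hasDerivAt_const _ _),
    deriv_mul_exp_sq_half (p := fun t => 0 + 1 * t) (p' := fun _ => 1)
      (fun t => by simpa using! hasDerivAt_id t),
    deriv_mul_exp_sq_half (p := fun t => 1 + (0 + 1 * t) * t) (p' := fun t => 2 * t) (fun t => ?_),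
    deriv_mul_exp_sq_half (p := fun t => 2 * t + (1 + (0 + 1 * t) * t) * t)
      (p' := fun t => 3 + 3 * t ^ 2) (fun t => ?_)]
  · norm_num
  · have := (((hasDerivAt_id t).const_mul 3).add ((hasDerivAt_id t).pow 3))
    convert! this using 1
    · ext s; simp; ring
    · simp
  · have := ((hasDerivAt_id t).pow 2).const_add 1
    convert! this using 1
    · ext s; simp; ring
    · simp

/-- The centred square of a standardized variable. -/
noncomputable def centeredSq (x : ℝ) : ℝ := x ^ 2 - 1

@[fun_prop]
lemma continuous_centeredSq : Continuous centeredSq := by unfold centeredSq; fun_prop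

@[fun_prop]
lemma measurable_centeredSq : Measurable centeredSq := continuous_centeredSq.measurable

lemma integrable_centeredSq_pow (k : ℕ) :
    Integrable (fun x => centeredSq x ^ k) (gaussianReal 0 1) := by
  exact (integrable_polynomial_gaussianReal ((Polynomial.X ^ 2 - 1) ^ k)).congr
    (ae_of_all _ fun x => by simp [centeredSq])

lemma integral_centeredSq : ∫ x, centeredSq x ∂(gaussianReal 0 1) = 0 := by
  unfold centeredSq
  rw [integral_sub (integrable_pow_gaussianReal 2) (integrable_const _), integral_sq_gaussianReal]
  simp

lemma integral_centeredSq_sq : ∫ x, centeredSq x ^ 2 ∂(gaussianReal 0 1) = 2 := by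
  have : ∀ x, centeredSq x ^ 2 = (x ^ 4 - 2 * x ^ 2) + 1 := fun x => by unfold centeredSq; ring
  simp_rw [this]
  have i1 := (integrable_pow_gaussianReal 2).const_mul 2
  have i2 : Integrable (fun x : ℝ => x ^ 4 - 2 * x ^ 2) (gaussianReal 0 1) :=
    (integrable_pow_gaussianReal 4).sub i1
  rw [integral_add i2 (integrable_const _),
    integral_sub (integrable_pow_gaussianReal 4) i1, integral_const_mul, integral_sq_gaussianReal,
    integral_pow_four_gaussianReal]
  norm_num

end GaussianMoments

/-! ### Factorization of integrals over disjoint sets of indices. -/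

section Independence

variable {Ω : Type*} [MeasurableSpace Ω] {P : Measure Ω}

/-- Integrals of products factorize for functions of disjoint sets of independent variables. -/
lemma ProbabilityTheory.iIndepFun.integral_mul_of_dependsOn {𝕜 : Type*} [RCLike 𝕜]
    {y : ℕ → Ω → ℝ} (hy : iIndepFun y P) (hm : ∀ t, AEMeasurable (y t) P) {S T : Finset ℕ}
    (hST : Disjoint S T) {F G : (ℕ → ℝ) → 𝕜} (hF : Measurable F) (hG : Measurable G)
    (hFS : DependsOn F (S : Set ℕ)) (hGT : DependsOn G (T : Set ℕ)) :
    ∫ ω, F (fun t => y t ω) * G (fun t => y t ω) ∂P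
      = (∫ ω, F (fun t => y t ω) ∂P) * ∫ ω, G (fun t => y t ω) ∂P := by
  classical
  -- Extension by zero turns a function of whole sequences into one of finitely many coordinates.
  -- The filler value is immaterial by `DependsOn`.
  let ext (S : Finset ℕ) (v : S → ℝ) (t : ℕ) : ℝ := if h : t ∈ S then v ⟨t, h⟩ else 0
  have hext : ∀ S, Measurable (ext S) := fun S => by
    refine measurable_pi_iff.2 fun t => ?_
    by_cases h : t ∈ S
    · simp only [ext, h, dif_pos]; fun_prop
    · simp only [ext, h, dif_neg, not_false_eq_true]; fun_prop
  have hF' : ∀ ω, F (fun t => y t ω) = (F ∘ ext S) (fun i : S => y i ω) := fun ω =>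
    hFS fun i hi => by simp [ext, Finset.mem_coe.1 hi]
  have hG' : ∀ ω, G (fun t => y t ω) = (G ∘ ext T) (fun i : T => y i ω) := fun ω =>
    hGT fun i hi => by simp [ext, Finset.mem_coe.1 hi]
  simp_rw [hF', hG']
  exact (hy.indepFun_finset₀ S T hST hm).integral_fun_comp_mul_comp
    (aemeasurable_pi_iff.2 fun i => hm i) (aemeasurable_pi_iff.2 fun i => hm i)
    (hF.comp (hext S)).aestronglyMeasurable (hG.comp (hext T)).aestronglyMeasurable

lemma ProbabilityTheory.HasLaw.integral_comp' {X : Ω → ℝ} {μ : Measure ℝ} (hX : HasLaw X μ P)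
    {f : ℝ → ℝ} (hf : Measurable f) : ∫ ω, f (X ω) ∂P = ∫ x, f x ∂μ :=
  hX.integral_comp hf.aestronglyMeasurable

lemma ProbabilityTheory.HasLaw.integrable_comp' {X : Ω → ℝ} {μ : Measure ℝ} (hX : HasLaw X μ P)
    {f : ℝ → ℝ} (hf : Integrable f μ) : Integrable (fun ω => f (X ω)) P := by
  rw [← hX.map_eq] at hf
  exact hf.comp_aemeasurable hX.aemeasurable

end Independence

/-! ### Joint central limit theorem for lagged products of centred squares. -/

section LaggedProducts

/-- Linear combination, with weights `a`, of the lagged products of centred squares whose later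
factor has index `k + M`. -/
noncomputable def laggedProduct {d : ℕ} (M : ℕ) (τ : Fin d → ℕ) (a : Fin d → ℝ) (k : ℕ)
    (w : ℕ → ℝ) : ℝ :=
  (∑ i, a i * centeredSq (w (k + M - τ i))) * centeredSq (w (k + M))

variable {d : ℕ} {M : ℕ} {τ : Fin d → ℕ} {a : Fin d → ℝ}

@[fun_prop]
lemma measurable_laggedProduct (k : ℕ) : Measurable (laggedProduct M τ a k) := by
  unfold laggedProduct; fun_prop

lemma dependsOn_laggedProduct (hτM : ∀ i, τ i ≤ M) (k : ℕ) :
    DependsOn (laggedProduct M τ a k) (Finset.Icc k (k + M) : Finset ℕ) := by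
  intro v w h
  unfold laggedProduct
  have h' : ∀ i, k ≤ i → i ≤ k + M → v i = w i := fun i h1 h2 => h i (by simp [h1, h2])
  rw [h' (k + M) (by omega) le_rfl]
  congr 1
  refine Finset.sum_congr rfl fun i _ => ?_
  rw [h' _ (by have := hτM i; omega) (by omega)]

/-- The past sum never sees the variable of index `k + M`, the later factor of the next increment.
This is the source of the martingale property. -/
lemma dependsOn_sum_laggedProduct (hτM : ∀ i, τ i ≤ M) (k : ℕ) :
    DependsOn (fun w => ∑ t ∈ Finset.range k, laggedProduct M τ a t w)
      (Finset.range (k + M) : Finset ℕ) := by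
  intro v w h
  refine Finset.sum_congr rfl fun t ht => dependsOn_laggedProduct hτM t fun i hi => h i ?_
  simp only [Finset.coe_range, Set.mem_Iio, Finset.mem_range, Finset.coe_Icc, Set.mem_Icc] at *
  omega

variable {Ω : Type*} [MeasurableSpace Ω] {P : Measure Ω}
  {y : ℕ → Ω → ℝ}

/-- From ab ≤ a² + b² and the power mean inequality, which gives d⁵. It reduces third moments of
increments, uniformly in k, to a sixth moment of a single centred square. -/
lemma abs_laggedProduct_pow_three_le (k : ℕ) (w : ℕ → ℝ) :
    |laggedProduct M τ a k w| ^ 3 ≤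
      (d : ℝ) ^ 5 * ∑ i, |a i| ^ 6 * centeredSq (w (k + M - τ i)) ^ 6
        + centeredSq (w (k + M)) ^ 6 := by
  set W := ∑ i, a i * centeredSq (w (k + M - τ i)) with hW
  set u := centeredSq (w (k + M))
  have h1 : |laggedProduct M τ a k w| ^ 3 ≤ W ^ 6 + u ^ 6 := by
    have : |laggedProduct M τ a k w| ^ 3 = |W| ^ 3 * |u| ^ 3 := by
      unfold laggedProduct; rw [abs_mul, mul_pow]
    rw [this]
    have e1 : W ^ 6 = (|W| ^ 3) ^ 2 := by rw [← pow_mul, (by decide : Even (3 * 2)).pow_abs]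
    have e2 : u ^ 6 = (|u| ^ 3) ^ 2 := by rw [← pow_mul, (by decide : Even (3 * 2)).pow_abs]
    rw [e1, e2]
    nlinarith [sq_nonneg (|W| ^ 3 - |u| ^ 3), sq_nonneg (|W| ^ 3 + |u| ^ 3)]
  have h2 : W ^ 6 ≤ (d : ℝ) ^ 5 * ∑ i, |a i| ^ 6 * centeredSq (w (k + M - τ i)) ^ 6 := by
    have hb : |W| ≤ ∑ i, |a i * centeredSq (w (k + M - τ i))| := Finset.abs_sum_le_sum_abs _ _
    have := pow_sum_div_card_le_sum_pow (s := (Finset.univ : Finset (Fin d)))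
      (f := fun i => |a i * centeredSq (w (k + M - τ i))|) (fun i _ => abs_nonneg _) 5
    have e1 : W ^ 6 = |W| ^ 6 := by rw [(by decide : Even 6).pow_abs]
    have e3 : ∀ i, |a i * centeredSq (w (k + M - τ i))| ^ 6
        = |a i| ^ 6 * centeredSq (w (k + M - τ i)) ^ 6 := fun i => by
      rw [abs_mul, mul_pow, (by decide : Even 6).pow_abs (centeredSq _)]
    simp only [Finset.card_univ, Fintype.card_fin, e3] at this
    rw [e1]
    refine (pow_le_pow_left₀ (abs_nonneg _) hb 6).trans ?_
    rcases Nat.eq_zero_or_pos d with rfl | hd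
    · simp
    · rwa [div_le_iff₀' (by positivity)] at this
  linarith

lemma integrable_bound_laggedProduct (hlaw : ∀ t, HasLaw (y t) (gaussianReal 0 1) P) (k : ℕ) :
    Integrable (fun ω => (d : ℝ) ^ 5 * ∑ i, |a i| ^ 6 * centeredSq (y (k + M - τ i) ω) ^ 6
        + centeredSq (y (k + M) ω) ^ 6) P := by
  have h : ∀ t, Integrable (fun ω => centeredSq (y t ω) ^ 6) P := fun t =>
    (hlaw t).integrable_comp' (integrable_centeredSq_pow 6)
  exact ((integrable_finsetSum _ fun i _ => (h _).const_mul _).const_mul _).add (h _)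

lemma integrable_abs_laggedProduct_pow_three (hlaw : ∀ t, HasLaw (y t) (gaussianReal 0 1) P)
    (k : ℕ) : Integrable (fun ω => |laggedProduct M τ a k fun t => y t ω| ^ 3) P := by
  have hm : AEMeasurable (fun ω t => y t ω) P :=
    aemeasurable_pi_iff.2 fun t => (hlaw t).aemeasurable
  have hm' : AEMeasurable (fun ω => laggedProduct M τ a k fun t => y t ω) P :=
    (measurable_laggedProduct k).comp_aemeasurable hm
  refine (integrable_bound_laggedProduct (M := M) (τ := τ) (a := a) hlaw k).mono'
    (hm'.norm.pow_const 3).aestronglyMeasurable (ae_of_all _ fun ω => ?_)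
  rw [norm_pow, Real.norm_eq_abs, abs_abs]
  exact abs_laggedProduct_pow_three_le k _

lemma integral_abs_laggedProduct_pow_three_le (hlaw : ∀ t, HasLaw (y t) (gaussianReal 0 1) P)
    (k : ℕ) : ∫ ω, |laggedProduct M τ a k fun t => y t ω| ^ 3 ∂P ≤
      (d : ℝ) ^ 5 * ∑ i, |a i| ^ 6 * (∫ x, centeredSq x ^ 6 ∂(gaussianReal 0 1))
        + ∫ x, centeredSq x ^ 6 ∂(gaussianReal 0 1) := by
  have h : ∀ t, Integrable (fun ω => centeredSq (y t ω) ^ 6) P := fun t =>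
    (hlaw t).integrable_comp' (integrable_centeredSq_pow 6)
  have hi : ∀ t, ∫ ω, centeredSq (y t ω) ^ 6 ∂P = ∫ x, centeredSq x ^ 6 ∂(gaussianReal 0 1) :=
    fun t => (hlaw t).integral_comp' (f := fun x => centeredSq x ^ 6) (by fun_prop)
  refine (integral_mono (integrable_abs_laggedProduct_pow_three hlaw k)
    (integrable_bound_laggedProduct (M := M) (τ := τ) (a := a) hlaw k)
    fun ω => abs_laggedProduct_pow_three_le k _).trans (le_of_eq ?_)
  rw [integral_add ((integrable_finsetSum _ fun i _ => (h _).const_mul _).const_mul _) (h _),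
    integral_const_mul, integral_finsetSum _ fun i _ => (h _).const_mul _, hi]
  simp_rw [integral_const_mul, hi]

lemma integral_centeredSq_mul_centeredSq (hy : iIndepFun y P)
    (hlaw : ∀ t, HasLaw (y t) (gaussianReal 0 1) P) (s t : ℕ) :
    ∫ ω, centeredSq (y s ω) * centeredSq (y t ω) ∂P = if s = t then 2 else 0 := by
  split_ifs with h
  · subst h
    simp_rw [← sq]
    rw [(hlaw s).integral_comp' (f := fun x => centeredSq x ^ 2) (by fun_prop),
      integral_centeredSq_sq]
  · have := hy.integral_mul_of_dependsOn (fun t => (hlaw t).aemeasurable) (S := {s}) (T := {t})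
      (by simpa using h) (F := fun w => centeredSq (w s)) (G := fun w => centeredSq (w t))
      (by fun_prop) (by fun_prop) (fun v w h => by simp [h s (by simp)])
      (fun v w h => by simp [h t (by simp)])
    rw [this, (hlaw t).integral_comp' (by fun_prop), integral_centeredSq, mul_zero]

/-- As lags are positive, the weighted sum is independent of the later factor, of variance 2. As
lags are distinct, its cross terms vanish, leaving 2 ∑ a_i². -/
lemma integral_laggedProduct_sq (hy : iIndepFun y P)
    (hlaw : ∀ t, HasLaw (y t) (gaussianReal 0 1) P) (hτ : Function.Injective τ)
    (hτ1 : ∀ i, 1 ≤ τ i) (hτM : ∀ i, τ i ≤ M) (k : ℕ) :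
    ∫ ω, laggedProduct M τ a k (fun t => y t ω) ^ 2 ∂P = 4 * ∑ i, a i ^ 2 := by
  have hprod : ∀ s t, Integrable (fun ω => centeredSq (y s ω) * centeredSq (y t ω)) P :=
    fun s t => by
    have h : ∀ t, Integrable (fun ω => centeredSq (y t ω) ^ 2) P := fun t =>
      (hlaw t).integrable_comp' (integrable_centeredSq_pow 2)
    have hm := fun t => (hlaw t).aemeasurable
    refine ((h s).add (h t)).mono' ?_ (ae_of_all _ fun ω => ?_)
    · exact (((measurable_centeredSq.comp_aemeasurable (hm s))).mul
        (measurable_centeredSq.comp_aemeasurable (hm t))).aestronglyMeasurable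
    · simp only [Real.norm_eq_abs, Pi.add_apply, abs_le]
      constructor <;> nlinarith [sq_nonneg (centeredSq (y s ω) + centeredSq (y t ω)),
        sq_nonneg (centeredSq (y s ω) - centeredSq (y t ω))]
  have hfac := hy.integral_mul_of_dependsOn (fun t => (hlaw t).aemeasurable)
    (S := Finset.range (k + M)) (T := {k + M}) (by simp)
    (F := fun w => (∑ i, a i * centeredSq (w (k + M - τ i))) ^ 2)
    (G := fun w => centeredSq (w (k + M)) ^ 2) (by fun_prop) (by fun_prop)
    (fun v w h => by
      simp only
      congr 1
      refine Finset.sum_congr rfl fun i _ => ?_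
      rw [h (k + M - τ i) (by have := hτ1 i; have := hτM i; simp; omega)])
    (fun v w h => by simp [h (k + M) (by simp)])
  have hu2 : ∫ ω, centeredSq (y (k + M) ω) ^ 2 ∂P = 2 := by
    rw [(hlaw _).integral_comp' (f := fun x => centeredSq x ^ 2) (by fun_prop),
      integral_centeredSq_sq]
  have hW : ∫ ω, (∑ i, a i * centeredSq (y (k + M - τ i) ω)) ^ 2 ∂P = 2 * ∑ i, a i ^ 2 := by
    have e : ∀ ω, (∑ i, a i * centeredSq (y (k + M - τ i) ω)) ^ 2 =
        ∑ i, ∑ j, a i * a j *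
          (centeredSq (y (k + M - τ i) ω) * centeredSq (y (k + M - τ j) ω)) := fun ω => by
      rw [sq, Finset.sum_mul_sum]
      exact Finset.sum_congr rfl fun i _ => Finset.sum_congr rfl fun j _ => by ring
    simp_rw [e]
    rw [integral_finsetSum _ fun i _ => integrable_finsetSum _ fun j _ =>
      (hprod _ _).const_mul _, Finset.mul_sum]
    refine Finset.sum_congr rfl fun i _ => ?_
    rw [integral_finsetSum _ fun j _ => (hprod _ _).const_mul _,
      Finset.sum_eq_single i]
    · rw [integral_const_mul, integral_centeredSq_mul_centeredSq hy hlaw, if_pos rfl]; ring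
    · intro j _ hj
      rw [integral_const_mul, integral_centeredSq_mul_centeredSq hy hlaw, if_neg, mul_zero]
      have := hτM i
      have := hτM j
      intro h
      exact hj (hτ (by omega))
    · simp
  simp only [laggedProduct, mul_pow]
  rw [hfac, hW, hu2]
  ring

/-- Everything except the centred factor of index `k + M` depends on earlier indices only. -/
lemma integral_exp_mul_laggedProduct (hy : iIndepFun y P)
    (hlaw : ∀ t, HasLaw (y t) (gaussianReal 0 1) P)
    (hτ1 : ∀ i, 1 ≤ τ i) (hτM : ∀ i, τ i ≤ M) (k : ℕ) (s : ℝ) :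
    ∫ ω, Complex.exp (Complex.I * (s * ∑ t ∈ Finset.range k,
      laggedProduct M τ a t (fun t => y t ω) : ℝ)) *
        (laggedProduct M τ a k (fun t => y t ω) : ℂ) ∂P = 0 := by
  have hfac := hy.integral_mul_of_dependsOn (fun t => (hlaw t).aemeasurable)
    (S := Finset.range (k + M)) (T := {k + M}) (by simp)
    (F := fun w => Complex.exp (Complex.I * (s * ∑ t ∈ Finset.range k,
      laggedProduct M τ a t w : ℝ)) * ((∑ i, a i * centeredSq (w (k + M - τ i)) : ℝ) : ℂ))
    (G := fun w => (centeredSq (w (k + M)) : ℂ)) (by fun_prop) (by fun_prop)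
    (fun v w h => by
      have h1 := dependsOn_sum_laggedProduct (a := a) hτM k h
      simp only at h1 ⊢
      rw [h1]
      congr 2
      refine Finset.sum_congr rfl fun i _ => ?_
      rw [h (k + M - τ i) (by have := hτ1 i; have := hτM i; simp; omega)])
    (fun v w h => by simp [h (k + M) (by simp)])
  have h0 : ∫ ω, (centeredSq (y (k + M) ω) : ℂ) ∂P = 0 := by
    rw [integral_complex_ofReal, (hlaw _).integral_comp' (by fun_prop), integral_centeredSq]
    simp
  rw [h0, mul_zero] at hfac
  rw [← hfac]
  refine integral_congr_ae (ae_of_all _ fun ω => ?_)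
  simp only [laggedProduct]
  push_cast
  ring

/-- The delayed sum uses indices below `k`, while the increment uses only indices from `k` to `k +
M`. -/
lemma integral_exp_mul_laggedProduct_sq (hy : iIndepFun y P)
    (hlaw : ∀ t, HasLaw (y t) (gaussianReal 0 1) P) (hτ : Function.Injective τ)
    (hτ1 : ∀ i, 1 ≤ τ i) (hτM : ∀ i, τ i ≤ M) (k : ℕ) (s : ℝ) :
    ∫ ω, Complex.exp (Complex.I * (s * ∑ t ∈ Finset.range (k - M),
      laggedProduct M τ a t (fun t => y t ω) : ℝ)) *
        (laggedProduct M τ a k (fun t => y t ω) : ℂ) ^ 2 ∂P =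
      (4 * ∑ i, a i ^ 2 : ℝ) * ∫ ω, Complex.exp (Complex.I * (s * ∑ t ∈ Finset.range (k - M),
        laggedProduct M τ a t (fun t => y t ω) : ℝ)) ∂P := by
  have hfac := hy.integral_mul_of_dependsOn (fun t => (hlaw t).aemeasurable)
    (S := Finset.range k) (T := Finset.Icc k (k + M))
    (Finset.disjoint_left.2 fun i hi => by simp at hi ⊢; omega)
    (F := fun w => Complex.exp (Complex.I * (s * ∑ t ∈ Finset.range (k - M),
      laggedProduct M τ a t w : ℝ)))
    (G := fun w => (laggedProduct M τ a k w : ℂ) ^ 2) (by fun_prop) (by fun_prop)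
    (fun v w h => by
      have h1 : ∑ t ∈ Finset.range (k - M), laggedProduct M τ a t v
          = ∑ t ∈ Finset.range (k - M), laggedProduct M τ a t w := by
        refine Finset.sum_congr rfl fun t ht =>
          dependsOn_laggedProduct hτM t fun i hi => h i ?_
        simp at ht hi ⊢
        omega
      simp only [h1])
    (fun v w h => by simp only [dependsOn_laggedProduct (a := a) hτM k h])
  rw [hfac, mul_comm]
  congr 1
  rw [← integral_laggedProduct_sq (a := a) hy hlaw hτ hτ1 hτM k, ← integral_complex_ofReal]
  simp

/-- The vector of normalized sums of lagged products of centred squares. -/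
noncomputable def laggedVector (M : ℕ) (τ : Fin d → ℕ) (y : ℕ → Ω → ℝ) (n : ℕ) (ω : Ω) :
    EuclideanSpace ℝ (Fin d) :=
  WithLp.toLp 2 fun i => (√(n : ℝ))⁻¹ * (∑ t ∈ Finset.range n,
    centeredSq (y (t + M - τ i) ω) * centeredSq (y (t + M) ω)) / 2

lemma aemeasurable_laggedVector (hm : ∀ t, AEMeasurable (y t) P) (n : ℕ) :
    AEMeasurable (laggedVector M τ y n) P := by
  refine (WithLp.measurable_toLp 2 _).comp_aemeasurable (aemeasurable_pi_iff.2 fun i => ?_)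
  have := fun t => measurable_centeredSq.comp_aemeasurable (hm t)
  simp only [Function.comp_def] at this
  fun_prop

/-- Cramér–Wold reduction: each projection is a normalized sum of scalar increments with weights `θ
i / 2`. -/
lemma inner_laggedVector {Ω : Type*} {y : ℕ → Ω → ℝ} (θ : EuclideanSpace ℝ (Fin d)) (n : ℕ)
    (ω : Ω) : inner ℝ (laggedVector M τ y n ω) θ = (√(n : ℝ))⁻¹ * ∑ t ∈ Finset.range n,
      laggedProduct M τ (fun i => θ i / 2) t fun t => y t ω := by
  simp only [laggedVector, PiLp.inner_apply, RCLike.inner_apply, conj_trivial, laggedProduct]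
  simp_rw [Finset.sum_mul]
  rw [Finset.sum_comm, Finset.mul_sum]
  refine Finset.sum_congr rfl fun i _ => ?_
  simp_rw [mul_assoc]
  rw [← Finset.mul_sum]
  ring

/-- The exponent is ‖θ‖², written as the increment variance for the weights `θ i / 2`. -/
lemma charFun_map_pi_gaussianReal (θ : EuclideanSpace ℝ (Fin d)) :
    charFun ((Measure.pi fun _ : Fin d => gaussianReal 0 1).map
      (fun z => (WithLp.toLp 2 z : EuclideanSpace ℝ (Fin d)))) θ
      = ((Real.exp (-(4 * ∑ i, (θ i / 2) ^ 2) / 2) : ℝ) : ℂ) := by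
  have h : Measure.map (fun z => (WithLp.toLp 2 z : EuclideanSpace ℝ (Fin d)))
      (Measure.pi fun _ : Fin d => gaussianReal 0 1) = stdGaussian (EuclideanSpace ℝ (Fin d)) :=
    map_pi_eq_stdGaussian
  have hn : ‖θ‖ ^ 2 = 4 * ∑ i, (θ i / 2) ^ 2 := by
    rw [EuclideanSpace.real_norm_sq_eq, Finset.mul_sum]
    exact Finset.sum_congr rfl fun i _ => by ring
  rw [h, charFun_stdGaussian, ← hn]
  push_cast
  rfl

lemma tendsto_charFun_laggedVector [IsProbabilityMeasure P] (hy : iIndepFun y P)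
    (hlaw : ∀ t, HasLaw (y t) (gaussianReal 0 1) P) (hτ : Function.Injective τ)
    (hτ1 : ∀ i, 1 ≤ τ i) (hτM : ∀ i, τ i ≤ M) (θ : EuclideanSpace ℝ (Fin d)) :
    Tendsto (fun n => charFun (P.map (laggedVector M τ y n)) θ) atTop
      (nhds ((Real.exp (-(4 * ∑ i, (θ i / 2) ^ 2) / 2) : ℝ) : ℂ)) := by
  have hmy := fun t => (hlaw t).aemeasurable
  have h0 : 0 ≤ 4 * ∑ i, (θ i / 2) ^ 2 := by positivity
  have key := tendsto_integral_exp_inv_sqrt_mul_sum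
    (D := fun k ω => laggedProduct M τ (fun i => θ i / 2) k fun t => y t ω) (M := M)
    (σ2 := 4 * ∑ i, (θ i / 2) ^ 2)
    (C := (d : ℝ) ^ 5 * ∑ i, |θ i / 2| ^ 6 * (∫ x, centeredSq x ^ 6 ∂(gaussianReal 0 1))
        + ∫ x, centeredSq x ^ 6 ∂(gaussianReal 0 1))
    (fun k => (measurable_laggedProduct k).comp_aemeasurable (aemeasurable_pi_iff.2 hmy))
    (integrable_abs_laggedProduct_pow_three hlaw)
    (integral_abs_laggedProduct_pow_three_le hlaw) h0
    (integral_exp_mul_laggedProduct hy hlaw hτ1 hτM)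
    (integral_exp_mul_laggedProduct_sq hy hlaw hτ hτ1 hτM)
  refine key.congr fun n => ?_
  rw [charFun_apply, integral_map (aemeasurable_laggedVector hmy n) (by fun_prop)]
  refine integral_congr_ae (ae_of_all _ fun ω => ?_)
  simp only
  rw [mul_comm Complex.I, inner_laggedVector]

/-- Joint central limit theorem for the lagged products of centred squares of independent standard
normal variables. -/
theorem tendstoInDistribution_laggedVector [IsProbabilityMeasure P] (hy : iIndepFun y P)
    (hlaw : ∀ t, HasLaw (y t) (gaussianReal 0 1) P) (hτ : Function.Injective τ)
    (hτ1 : ∀ i, 1 ≤ τ i) (hτM : ∀ i, τ i ≤ M) :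
    TendstoInDistribution (laggedVector M τ y) atTop
      (fun z => (WithLp.toLp 2 z : EuclideanSpace ℝ (Fin d))) (fun _ => P)
      (Measure.pi fun _ : Fin d => gaussianReal 0 1) := by
  refine ⟨aemeasurable_laggedVector fun t => (hlaw t).aemeasurable, by fun_prop, ?_⟩
  refine ProbabilityMeasure.tendsto_iff_tendsto_charFun.2 fun θ => ?_
  simp only [ProbabilityMeasure.coe_mk]
  rw [charFun_map_pi_gaussianReal]
  exact tendsto_charFun_laggedVector hy hlaw hτ hτ1 hτM θ

/-- The sum of squares of the normalized lagged products is asymptotically chi-squared. -/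
theorem tendstoInDistribution_sum_sq_laggedProduct [IsProbabilityMeasure P] (hy : iIndepFun y P)
    (hlaw : ∀ t, HasLaw (y t) (gaussianReal 0 1) P) (hτ : Function.Injective τ)
    (hτ1 : ∀ i, 1 ≤ τ i) (hτM : ∀ i, τ i ≤ M) :
    TendstoInDistribution (fun (n : ℕ) ω => ∑ i : Fin d, ((√n)⁻¹ * (∑ t ∈ Finset.range n,
      centeredSq (y (t + M - τ i) ω) * centeredSq (y (t + M) ω)) / 2) ^ 2)
      atTop (id : ℝ → ℝ) (fun _ => P) (chiSquared d) := by
  have h := (tendstoInDistribution_laggedVector hy hlaw hτ hτ1 hτM).continuous_comp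
    (g := fun v : EuclideanSpace ℝ (Fin d) => ∑ i, v i ^ 2) (by fun_prop)
  refine ⟨h.forall_aemeasurable, by fun_prop, ?_⟩
  convert! h.tendsto using 2
  simp [chiSquared, Function.comp_def]

end LaggedProducts

/-! ### Calculus of boundedness and negligibility in probability. -/

section StochasticOrder

variable {Ω : Type*} [MeasurableSpace Ω]

/-- The sequence `X` is bounded in probability. -/
def IsBoundedInProb (P : Measure Ω) (X : ℕ → Ω → ℝ) : Prop :=
  ∀ δ > 0, ∃ K : ℝ, 0 < K ∧ ∀ᶠ n in atTop, P.real {ω | K ≤ |X n ω|} ≤ δ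

/-- The sequence `X` converges to zero in probability. -/
def IsNegligibleInProb (P : Measure Ω) (X : ℕ → Ω → ℝ) : Prop :=
  ∀ ε > 0, ∀ δ > 0, ∀ᶠ n in atTop, P.real {ω | ε ≤ |X n ω|} ≤ δ

variable {P : Measure Ω} {X Y : ℕ → Ω → ℝ}

lemma measureReal_le_of_subset_union [IsProbabilityMeasure P] {s t u : Set Ω} (h : s ⊆ t ∪ u) :
    P.real s ≤ P.real t + P.real u :=
  (measureReal_mono h).trans (measureReal_union_le _ _)

namespace IsBoundedInProb

lemma add [IsProbabilityMeasure P] (hX : IsBoundedInProb P X) (hY : IsBoundedInProb P Y) :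
    IsBoundedInProb P (fun n ω => X n ω + Y n ω) := by
  intro δ hδ
  obtain ⟨K, hK, h1⟩ := hX (δ / 2) (half_pos hδ)
  obtain ⟨L, hL, h2⟩ := hY (δ / 2) (half_pos hδ)
  refine ⟨K + L, add_pos hK hL, ?_⟩
  filter_upwards [h1, h2] with n h1 h2
  refine (measureReal_le_of_subset_union (P := P) fun ω hω => ?_).trans
    ((add_le_add h1 h2).trans (add_halves δ).le)
  by_contra hn
  simp only [Set.mem_union, Set.mem_ofPred_eq, not_or, not_le] at hn hω
  linarith [abs_add_le (X n ω) (Y n ω)]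

lemma mul [IsProbabilityMeasure P] (hX : IsBoundedInProb P X) (hY : IsBoundedInProb P Y) :
    IsBoundedInProb P (fun n ω => X n ω * Y n ω) := by
  intro δ hδ
  obtain ⟨K, hK, h1⟩ := hX (δ / 2) (half_pos hδ)
  obtain ⟨L, hL, h2⟩ := hY (δ / 2) (half_pos hδ)
  refine ⟨K * L, mul_pos hK hL, ?_⟩
  filter_upwards [h1, h2] with n h1 h2
  refine (measureReal_le_of_subset_union (P := P) fun ω hω => ?_).trans
    ((add_le_add h1 h2).trans (add_halves δ).le)
  by_contra hn
  simp only [Set.mem_union, Set.mem_ofPred_eq, not_or, not_le, abs_mul] at hn hω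
  exact absurd hω (not_le.2 (mul_lt_mul'' hn.1 hn.2 (abs_nonneg _) (abs_nonneg _)))

lemma of_abs_le {c : ℕ → ℝ} {K : ℝ} (h : ∀ᶠ n in atTop, |c n| ≤ K) :
    IsBoundedInProb P (fun n _ => c n) := by
  intro δ hδ
  refine ⟨max K 0 + 1, by positivity, ?_⟩
  filter_upwards [h] with n hn
  have : {ω : Ω | max K 0 + 1 ≤ |c n|} = ∅ := by
    ext ω
    simp only [Set.mem_ofPred_eq, Set.mem_empty_iff_false, iff_false, not_le]
    linarith [le_max_left K 0]
  rw [this, measureReal_empty]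
  exact hδ.le

lemma const (c : ℝ) : IsBoundedInProb P (fun _ _ => c) :=
  of_abs_le (K := |c|) (Eventually.of_forall fun _ => le_rfl)

lemma neg (hX : IsBoundedInProb P X) : IsBoundedInProb P (fun n ω => -X n ω) := by
  simpa [IsBoundedInProb] using hX

lemma sub [IsProbabilityMeasure P] (hX : IsBoundedInProb P X) (hY : IsBoundedInProb P Y) :
    IsBoundedInProb P (fun n ω => X n ω - Y n ω) := by
  simpa only [sub_eq_add_neg] using hX.add hY.neg

lemma pow [IsProbabilityMeasure P] (hX : IsBoundedInProb P X) (k : ℕ) :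
    IsBoundedInProb P (fun n ω => X n ω ^ k) := by
  induction k with
  | zero => simpa using const 1
  | succ k ih => simpa only [pow_succ] using ih.mul hX

/-- A sequence with bounded second moments is bounded in probability. -/
lemma of_integral_sq_le [IsProbabilityMeasure P] {C : ℝ}
    (hi : ∀ n, Integrable (fun ω => X n ω ^ 2) P)
    (hC : ∀ n, ∫ ω, X n ω ^ 2 ∂P ≤ C) : IsBoundedInProb P X := by
  intro δ hδ
  have hC0 : 0 ≤ C := (integral_nonneg fun ω => sq_nonneg _).trans (hC 0)
  -- Chebyshev's inequality. The added 1 keeps the witness positive when C = 0.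
  refine ⟨√((C + 1) / δ), Real.sqrt_pos.2 (by positivity), Eventually.of_forall fun n => ?_⟩
  have hm := mul_meas_ge_le_integral_of_nonneg (ae_of_all _ fun ω => sq_nonneg (X n ω)) (hi n)
    ((C + 1) / δ)
  have hsub : {ω | √((C + 1) / δ) ≤ |X n ω|} ⊆ {ω | (C + 1) / δ ≤ X n ω ^ 2} := fun ω hω => by
    have h := pow_le_pow_left₀ (Real.sqrt_nonneg _) (Set.mem_ofPred_eq ▸ hω) 2
    rwa [Real.sq_sqrt (by positivity), sq_abs] at h
  refine (measureReal_mono hsub).trans ?_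
  have h2 : (C + 1) / δ * P.real {ω | (C + 1) / δ ≤ X n ω ^ 2} ≤ (C + 1) / δ * δ := by
    rw [div_mul_cancel₀ _ hδ.ne']
    linarith [hC n]
  exact le_of_mul_le_mul_left h2 (by positivity)

end IsBoundedInProb

namespace IsNegligibleInProb

lemma isBoundedInProb (hX : IsNegligibleInProb P X) : IsBoundedInProb P X :=
  fun δ hδ => ⟨1, one_pos, hX 1 one_pos δ hδ⟩

lemma add [IsProbabilityMeasure P] (hX : IsNegligibleInProb P X) (hY : IsNegligibleInProb P Y) :
    IsNegligibleInProb P (fun n ω => X n ω + Y n ω) := by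
  intro ε hε δ hδ
  filter_upwards [hX (ε / 2) (half_pos hε) (δ / 2) (half_pos hδ),
    hY (ε / 2) (half_pos hε) (δ / 2) (half_pos hδ)] with n h1 h2
  refine (measureReal_le_of_subset_union (P := P) fun ω hω => ?_).trans
    ((add_le_add h1 h2).trans (add_halves δ).le)
  by_contra hn
  simp only [Set.mem_union, Set.mem_ofPred_eq, not_or, not_le] at hn hω
  linarith [abs_add_le (X n ω) (Y n ω)]

lemma mul [IsProbabilityMeasure P] (hX : IsNegligibleInProb P X) (hY : IsBoundedInProb P Y) :
    IsNegligibleInProb P (fun n ω => X n ω * Y n ω) := by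
  intro ε hε δ hδ
  obtain ⟨K, hK, h2⟩ := hY (δ / 2) (half_pos hδ)
  filter_upwards [hX (ε / K) (by positivity) (δ / 2) (half_pos hδ), h2] with n h1 h2
  refine (measureReal_le_of_subset_union (P := P) fun ω hω => ?_).trans
    ((add_le_add h1 h2).trans (add_halves δ).le)
  by_contra hn
  simp only [Set.mem_union, Set.mem_ofPred_eq, not_or, not_le, abs_mul] at hn hω
  have := mul_lt_mul'' hn.1 hn.2 (abs_nonneg _) (abs_nonneg _)
  rw [div_mul_cancel₀ _ hK.ne'] at this
  linarith

lemma of_tendsto {c : ℕ → ℝ} (h : Tendsto c atTop (nhds 0)) :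
    IsNegligibleInProb P (fun n _ => c n) := by
  intro ε hε δ hδ
  filter_upwards [(Metric.tendsto_nhds.1 h) ε hε] with n hn
  rw [Real.dist_eq, sub_zero] at hn
  have : {ω : Ω | ε ≤ |c n|} = ∅ := by
    ext ω
    simpa using hn
  rw [this, measureReal_empty]
  exact hδ.le

lemma congr (hX : IsNegligibleInProb P X) (h : ∀ᶠ n in atTop, ∀ ω, X n ω = Y n ω) :
    IsNegligibleInProb P Y := by
  intro ε hε δ hδ
  filter_upwards [hX ε hε δ hδ, h] with n h1 h2
  simpa only [h2] using h1

lemma sum [IsProbabilityMeasure P] {ι : Type*} {s : Finset ι} {Z : ι → ℕ → Ω → ℝ}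
    (h : ∀ i ∈ s, IsNegligibleInProb P (Z i)) :
    IsNegligibleInProb P (fun n ω => ∑ i ∈ s, Z i n ω) := by
  classical
  induction s using Finset.induction_on with
  | empty => simpa using of_tendsto tendsto_const_nhds
  | insert i s hi ih =>
    simp only [Finset.sum_insert hi]
    exact (h i (by simp)).add (ih fun j hj => h j (by simp [hj]))

/-- If `X` converges to `a` in probability and `g` is continuous at `a` then `g (X n)` converges to
`g a` in probability. -/
lemma comp_continuousAt [IsProbabilityMeasure P] {a : ℝ} {g : ℝ → ℝ} (hg : ContinuousAt g a)
    (hX : IsNegligibleInProb P (fun n ω => X n ω - a)) :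
    IsNegligibleInProb P (fun n ω => g (X n ω) - g a) := by
  intro ε hε δ hδ
  obtain ⟨η, hη, h⟩ := Metric.continuousAt_iff.1 hg ε hε
  filter_upwards [hX η hη δ hδ] with n hn
  refine (measureReal_mono fun ω hω => ?_).trans hn
  by_contra hc
  simp only [Set.mem_ofPred_eq, not_le] at hc hω
  have := h (x := X n ω) (by rwa [Real.dist_eq])
  rw [Real.dist_eq] at this
  linarith

/-- A sequence that vanishes wherever `X n` is close to zero is negligible if `X` is. -/
lemma of_eq_zero_of_abs_lt [IsProbabilityMeasure P] (hX : IsNegligibleInProb P X) {c : ℝ}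
    (hc : 0 < c)
    (h : ∀ n ω, |X n ω| < c → Y n ω = 0) : IsNegligibleInProb P Y := by
  intro ε hε δ hδ
  filter_upwards [hX c hc δ hδ] with n hn
  refine (measureReal_mono fun ω hω => ?_).trans hn
  by_contra hlt
  simp only [Set.mem_ofPred_eq, not_le] at hlt hω
  rw [h n ω hlt, abs_zero] at hω
  linarith

lemma tendstoInMeasure [IsProbabilityMeasure P] (hX : IsNegligibleInProb P X) :
    TendstoInMeasure P X atTop 0 := by
  rw [tendstoInMeasure_iff_measureReal_norm]
  intro ε hε
  simp only [Pi.zero_apply, sub_zero, Real.norm_eq_abs]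
  rw [Metric.tendsto_nhds]
  intro δ hδ
  filter_upwards [hX ε hε (δ / 2) (half_pos hδ)] with n hn
  rw [Real.dist_eq, sub_zero, abs_of_nonneg measureReal_nonneg]
  linarith

end IsNegligibleInProb

end StochasticOrder

/-! ### Second-moment bounds for sums of orthogonal variables. -/

section OrthogonalSums

variable {Ω : Type*} [MeasurableSpace Ω] {P : Measure Ω} {ξ : ℕ → Ω → ℝ} {C : ℝ}

/-- Second-moment bounds for sums of orthogonal random variables. -/
structure IsOrthogonalBounded (P : Measure Ω) (ξ : ℕ → Ω → ℝ) (C : ℝ) : Prop where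
  aemeasurable : ∀ t, AEMeasurable (ξ t) P
  integrable_sq : ∀ t, Integrable (fun ω => ξ t ω ^ 2) P
  integral_sq_le : ∀ t, ∫ ω, ξ t ω ^ 2 ∂P ≤ C
  integral_mul : ∀ s t, s < t → ∫ ω, ξ s ω * ξ t ω ∂P = 0

namespace IsOrthogonalBounded

lemma integrable_mul (h : IsOrthogonalBounded P ξ C) (s t : ℕ) :
    Integrable (fun ω => ξ s ω * ξ t ω) P := by
  refine ((h.integrable_sq s).add (h.integrable_sq t)).mono'
    ((h.aemeasurable s).mul (h.aemeasurable t)).aestronglyMeasurable (ae_of_all _ fun ω => ?_)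
  simp only [Real.norm_eq_abs, Pi.add_apply, abs_le]
  constructor <;> nlinarith [sq_nonneg (ξ s ω + ξ t ω), sq_nonneg (ξ s ω - ξ t ω)]

lemma sq_sum {Ω : Type*} {ξ : ℕ → Ω → ℝ} (I : Finset ℕ) (ω : Ω) :
    (∑ t ∈ I, ξ t ω) ^ 2 = ∑ s ∈ I, ∑ t ∈ I, ξ s ω * ξ t ω := by
  rw [sq, Finset.sum_mul_sum]

lemma integrable_sum_sq (h : IsOrthogonalBounded P ξ C) (I : Finset ℕ) :
    Integrable (fun ω => (∑ t ∈ I, ξ t ω) ^ 2) P := by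
  simp_rw [sq_sum]
  exact integrable_finsetSum _ fun s _ => integrable_finsetSum _ fun t _ => h.integrable_mul s t

lemma integral_sum_sq_le (h : IsOrthogonalBounded P ξ C) (I : Finset ℕ) :
    ∫ ω, (∑ t ∈ I, ξ t ω) ^ 2 ∂P ≤ I.card * C := by
  simp_rw [sq_sum]
  rw [integral_finsetSum _ fun s _ => integrable_finsetSum _ fun t _ => h.integrable_mul s t,
    ← nsmul_eq_mul]
  refine Finset.sum_le_card_nsmul _ _ _ fun s hs => ?_
  rw [integral_finsetSum _ fun t _ => h.integrable_mul s t, Finset.sum_eq_single s]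
  · simpa only [sq] using h.integral_sq_le s
  · intro t _ hts
    rcases lt_or_gt_of_ne hts with hlt | hlt
    · simpa only [mul_comm] using h.integral_mul t s hlt
    · exact h.integral_mul s t hlt
  · exact fun hn => absurd hs hn

lemma nonneg (h : IsOrthogonalBounded P ξ C) : 0 ≤ C :=
  (integral_nonneg fun _ => sq_nonneg _).trans (h.integral_sq_le 0)

/-- Normalized sums of at most `n` orthogonal terms are bounded in probability. -/
lemma isBoundedInProb_inv_sqrt_mul_sum [IsProbabilityMeasure P]
    (h : IsOrthogonalBounded P ξ C) {I : ℕ → Finset ℕ}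
    (hI : ∀ n, (I n).card ≤ n) :
    IsBoundedInProb P (fun n ω => (√(n : ℝ))⁻¹ * ∑ t ∈ I n, ξ t ω) := by
  refine IsBoundedInProb.of_integral_sq_le (C := C) (fun n => ?_) (fun n => ?_)
  · simp_rw [mul_pow]
    exact (h.integrable_sum_sq _).const_mul _
  · simp_rw [mul_pow]
    rw [integral_const_mul, inv_pow, Real.sq_sqrt (Nat.cast_nonneg n)]
    have h1 : ∫ ω, (∑ t ∈ I n, ξ t ω) ^ 2 ∂P ≤ n * C :=
      (h.integral_sum_sq_le _).trans (mul_le_mul_of_nonneg_right (by exact_mod_cast hI n) h.nonneg)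
    rcases Nat.eq_zero_or_pos n with rfl | hn
    · simpa using h.nonneg
    · rw [inv_mul_le_iff₀ (by exact_mod_cast hn)]
      exact h1

/-- Sums of a bounded number of orthogonal terms are bounded in probability. -/
lemma isBoundedInProb_sum [IsProbabilityMeasure P] (h : IsOrthogonalBounded P ξ C)
    {I : ℕ → Finset ℕ} {K : ℕ}
    (hI : ∀ n, (I n).card ≤ K) :
    IsBoundedInProb P (fun n ω => ∑ t ∈ I n, ξ t ω) :=
  IsBoundedInProb.of_integral_sq_le (C := K * C) (fun n => h.integrable_sum_sq _) fun n =>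
    (h.integral_sum_sq_le _).trans (mul_le_mul_of_nonneg_right (by exact_mod_cast hI n) h.nonneg)

end IsOrthogonalBounded

variable {y : ℕ → Ω → ℝ}

/-- Centred functions of independent identically distributed variables are orthogonal. -/
lemma isOrthogonalBounded_comp (hy : iIndepFun y P) {μ : Measure ℝ}
    (hlaw : ∀ t, HasLaw (y t) μ P) {f : ℝ → ℝ} (hf : Measurable f)
    (hf2 : Integrable (fun x => f x ^ 2) μ) (hf0 : ∫ x, f x ∂μ = 0) :
    IsOrthogonalBounded P (fun t ω => f (y t ω)) (∫ x, f x ^ 2 ∂μ) where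
  aemeasurable t := hf.comp_aemeasurable (hlaw t).aemeasurable
  integrable_sq t := (hlaw t).integrable_comp' hf2
  integral_sq_le t := ((hlaw t).integral_comp' (f := fun x => f x ^ 2) (by fun_prop)).le
  integral_mul s t hst := by
    have := hy.integral_mul_of_dependsOn (fun t => (hlaw t).aemeasurable) (S := {s}) (T := {t})
      (by simpa using hst.ne) (F := fun w => f (w s)) (G := fun w => f (w t))
      (by fun_prop) (by fun_prop) (fun v w h => by simp [h s (by simp)])
      (fun v w h => by simp [h t (by simp)])
    rw [this, (hlaw t).integral_comp' hf, hf0, mul_zero]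

/-- Lagged products of functions of independent identically distributed variables are orthogonal
if the later factor is centred. -/
lemma isOrthogonalBounded_comp_mul_comp (hy : iIndepFun y P) {μ : Measure ℝ}
    (hlaw : ∀ t, HasLaw (y t) μ P) {f g : ℝ → ℝ} (hf : Measurable f) (hg : Measurable g)
    (hf4 : Integrable (fun x => f x ^ 4) μ) (hg4 : Integrable (fun x => g x ^ 4) μ)
    (hg0 : ∫ x, g x ∂μ = 0) {τ : ℕ} (hτ : 1 ≤ τ) :
    IsOrthogonalBounded P (fun t ω => f (y t ω) * g (y (t + τ) ω))
      ((∫ x, f x ^ 2 ∂μ) * ∫ x, g x ^ 2 ∂μ) where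
  aemeasurable t := (hf.comp_aemeasurable (hlaw t).aemeasurable).mul
    (hg.comp_aemeasurable (hlaw (t + τ)).aemeasurable)
  integrable_sq t := by
    have hm := ((hf.comp_aemeasurable (hlaw t).aemeasurable).mul
      (hg.comp_aemeasurable (hlaw (t + τ)).aemeasurable)).pow_const 2
    refine (((hlaw t).integrable_comp' hf4).add ((hlaw (t + τ)).integrable_comp' hg4)).mono'
      hm.aestronglyMeasurable (ae_of_all _ fun ω => ?_)
    rw [Real.norm_of_nonneg (sq_nonneg _), Pi.add_apply]
    nlinarith [sq_nonneg (f (y t ω) ^ 2 - g (y (t + τ) ω) ^ 2),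
      sq_nonneg (f (y t ω) ^ 2 + g (y (t + τ) ω) ^ 2)]
  integral_sq_le t := by
    have := hy.integral_mul_of_dependsOn (fun t => (hlaw t).aemeasurable) (S := {t})
      (T := {t + τ}) (by simp; omega) (F := fun w => f (w t) ^ 2) (G := fun w => g (w (t + τ)) ^ 2)
      (by fun_prop) (by fun_prop) (fun v w h => by simp [h t (by simp)])
      (fun v w h => by simp [h (t + τ) (by simp)])
    simp_rw [mul_pow]
    rw [this, (hlaw t).integral_comp' (f := fun x => f x ^ 2) (by fun_prop),
      (hlaw (t + τ)).integral_comp' (f := fun x => g x ^ 2) (by fun_prop)]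
  integral_mul s t hst := by
    -- Only the latest factor is split off, since `s + τ` may coincide with `t`. All other indices
    -- are below `t + τ` because s < t and τ ≥ 1.
    have := hy.integral_mul_of_dependsOn (fun t => (hlaw t).aemeasurable)
      (S := Finset.range (t + τ)) (T := {t + τ}) (by simp)
      (F := fun w => f (w s) * g (w (s + τ)) * f (w t)) (G := fun w => g (w (t + τ)))
      (by fun_prop) (by fun_prop)
      (fun v w h => by
        simp only
        rw [h s (by simp; omega), h (s + τ) (by simp; omega), h t (by simp; omega)])
      (fun v w h => by simp [h (t + τ) (by simp)])
    simp_rw [← mul_assoc]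
    rw [this, (hlaw (t + τ)).integral_comp' hg, hg0, mul_zero]

end OrthogonalSums

/-! ### Expansion of the empirical moments. -/

section Algebra

lemma sum_sq_sub_eq (y : ℕ → ℝ) (m : ℝ) (n : ℕ) :
    ∑ t ∈ Finset.range n, (y t - m) ^ 2 = ∑ t ∈ Finset.range n, centeredSq (y t)
      - 2 * m * ∑ t ∈ Finset.range n, y t + n * (1 + m ^ 2) := by
  induction n with
  | zero => simp
  | succ n ih =>
    simp only [Finset.sum_range_succ, ih, centeredSq]
    push_cast
    ring

/-- Multiply two copies of (y - m)² = (y² - 1) - 2my + (1 + m²). Apart from the constant term, only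
sums of orthogonal centred variables occur when τ ≥ 1. -/
lemma sum_sq_sub_mul_sq_sub_eq (y : ℕ → ℝ) (m : ℝ) (τ n : ℕ) :
    ∑ t ∈ Finset.range n, (y t - m) ^ 2 * (y (t + τ) - m) ^ 2 =
      ∑ t ∈ Finset.range n, centeredSq (y t) * centeredSq (y (t + τ))
      + (1 + m ^ 2) * (∑ t ∈ Finset.range n, centeredSq (y t)
        + ∑ t ∈ Finset.range n, centeredSq (y (t + τ)))
      - 2 * m * (∑ t ∈ Finset.range n, centeredSq (y t) * y (t + τ)
        + ∑ t ∈ Finset.range n, y t * centeredSq (y (t + τ)))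
      + 4 * m ^ 2 * ∑ t ∈ Finset.range n, y t * y (t + τ)
      - 2 * m * (1 + m ^ 2) * (∑ t ∈ Finset.range n, y t + ∑ t ∈ Finset.range n, y (t + τ))
      + n * (1 + m ^ 2) ^ 2 := by
  induction n with
  | zero => simp
  | succ n ih =>
    simp only [Finset.sum_range_succ, ih, centeredSq]
    push_cast
    ring

lemma sum_range_sub_eq_sub_Ico (f : ℕ → ℝ) (τ n : ℕ) :
    ∑ t ∈ Finset.range (n - τ), f t
      = ∑ t ∈ Finset.range n, f t - ∑ t ∈ Finset.Ico (n - τ) n, f t := by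
  rw [← Finset.sum_range_add_sum_Ico f (Nat.sub_le n τ)]
  ring

lemma sum_range_sub_shift_eq_sub_range (f : ℕ → ℝ) {τ n : ℕ} (h : τ ≤ n) :
    ∑ t ∈ Finset.range (n - τ), f (t + τ)
      = ∑ t ∈ Finset.range n, f t - ∑ t ∈ Finset.range τ, f t := by
  rw [← Finset.sum_range_add_sum_Ico f h, Finset.sum_Ico_eq_sum_range]
  simp_rw [add_comm]
  ring

/-- Normalized empirical lagged product moment of the squared deviations, expanded around that of
the centred squares. Here `r = n ^ (-1/2)` and `N = n - τ`. -/
lemma lagged_moment_expansion {r N U Y A B₁ B₂ G dU₁ dU₂ dY₁ dY₂ : ℝ} (hr : r ≠ 0) (hN : N ≠ 0) :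
    r⁻¹ * ((A / r + (1 + (r * Y) ^ 2) * ((U / r - dU₁) + (U / r - dU₂))
      - 2 * (r * Y) * (B₁ / r + B₂ / r) + 4 * (r * Y) ^ 2 * (G / r)
      - 2 * (r * Y) * (1 + (r * Y) ^ 2) * ((Y / r - dY₁) + (Y / r - dY₂))
      + N * (1 + (r * Y) ^ 2) ^ 2) / N - (1 + r * U - r ^ 2 * Y ^ 2) ^ 2)
    = (r⁻¹ ^ 2 / N) * A + r * ((r⁻¹ ^ 2 / N) * ((1 + r * U - r ^ 2 * Y ^ 2) *
        ((2 * r * Y * dY₁ - dU₁ - (r⁻¹ ^ 2 - N) * r * (2 * r * Y ^ 2 - U))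
          + (2 * r * Y * dY₂ - dU₂ - (r⁻¹ ^ 2 - N) * r * (2 * r * Y ^ 2 - U)))
        + ((2 * r * Y ^ 2 - U) * (2 * U - r * (dU₁ + dU₂)) - 2 * Y * (B₁ + B₂)
          + 4 * r * Y ^ 2 * G
          - 2 * r * Y * (2 * r * Y ^ 2 - U) * (2 * Y - r * dY₁ - r * dY₂)))
        + (2 * r * Y ^ 2 - U) ^ 2) := by
  field_simp
  ring

end Algebra

/-! ### Divisors, affine invariance and measurability. -/

section Deterministic

lemma tendsto_natCast_div_sub_natCast (k : ℕ) :
    Tendsto (fun n : ℕ => (n : ℝ) / ((n : ℝ) - k)) atTop (nhds 1) := by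
  simpa [sub_eq_add_neg] using tendsto_natCast_div_add_atTop (-(k : ℝ))

/-- The choice of divisor changes the squared variance by a relative O(1/n), which is still
negligible after multiplication by √n. -/
lemma abs_mul_one_sub_sq_le {d n : ℕ} (hd : d = 0 ∨ d = 1) (hn : 2 ≤ n) :
    |(n : ℝ) * (1 - ((n : ℝ) / ((n : ℝ) - d)) ^ 2)| ≤ 8 := by
  have hn' : (2 : ℝ) ≤ n := by exact_mod_cast hn
  rcases hd with rfl | rfl
  · have : (n : ℝ) ≠ 0 := by positivity
    simp [this]
  · have h1 : (0 : ℝ) < n - 1 := by linarith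
    have e : (n : ℝ) * (1 - ((n : ℝ) / ((n : ℝ) - (1 : ℕ))) ^ 2)
        = -((n : ℝ) * (2 * n - 1) / ((n : ℝ) - 1) ^ 2) := by
      push_cast
      field_simp
      ring
    rw [e, abs_neg, abs_of_nonneg (by apply div_nonneg <;> nlinarith), div_le_iff₀ (by positivity)]
    nlinarith

lemma standardized_sq {d n : ℕ} (hd : d ≤ n) (x : ℕ → ℝ) (t : ℕ) :
    standardized d n x t ^ 2 = (x t - sampleMean n x) ^ 2 / sampleVar d n x := by
  have h : 0 ≤ sampleVar d n x :=
    div_nonneg (Finset.sum_nonneg fun _ _ => sq_nonneg _) (sub_nonneg.2 (by exact_mod_cast hd))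
  rw [standardized, div_pow, Real.sq_sqrt h]

/-- Standardization removes location and scale. -/
lemma standardized_affine {d n : ℕ} (hn : 1 ≤ n) {x y : ℕ → ℝ} {m s : ℝ} (hs : 0 < s)
    (hxy : ∀ t, x t = m + s * y t) : standardized d n x = standardized d n y := by
  have hn0 : (n : ℝ) ≠ 0 := by exact_mod_cast (by omega : n ≠ 0)
  have hmean : sampleMean n x = m + s * sampleMean n y := by
    simp only [sampleMean, hxy, Finset.sum_add_distrib, ← Finset.mul_sum, Finset.sum_const,
      Finset.card_range, nsmul_eq_mul]
    field_simp
  have hdev : ∀ t, x t - sampleMean n x = s * (y t - sampleMean n y) := fun t => by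
    rw [hmean, hxy]; ring
  have hvar : sampleVar d n x = s ^ 2 * sampleVar d n y := by
    simp only [sampleVar, hdev, mul_pow, ← Finset.mul_sum, mul_div_assoc]
  ext t
  rw [standardized, standardized, hdev, hvar, Real.sqrt_mul (sq_nonneg s), Real.sqrt_sq hs.le,
    mul_div_mul_left _ _ hs.ne']

lemma measurable_volatilityStat (d : ℕ) (T : Finset ℕ) (n : ℕ) :
    Measurable (volatilityStat d T n) := by
  unfold volatilityStat standardized sampleVar sampleMean
  fun_prop

end Deterministic

/-! ### Negligibility of the remainder of the expansion. -/

section Negligible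

variable {Ω : Type*} [MeasurableSpace Ω] {P : Measure Ω}

lemma isBoundedInProb_of_tendsto {c : ℕ → ℝ} {l : ℝ} (h : Tendsto c atTop (nhds l)) :
    IsBoundedInProb P (fun n _ => c n) :=
  IsBoundedInProb.of_abs_le (K := |l| + 1)
    ((h.abs.eventually_lt_const (lt_add_one |l|)).mono fun _ hn => hn.le)

/-- With c = 1 + rU - r²Y² and b = 2rY² - U one has 1 + (rY)² = c + rb. The remainder is (κ - 1)A
plus r times a polynomial in bounded quantities. In the application κ = n/(n - τ), `η` carries the
effect of the divisor, and the `dU`, `dY` are sums over the τ terms cut off at either end. -/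
lemma isNegligibleInProb_expansion_remainder [IsProbabilityMeasure P] {κ r η : ℕ → ℝ} {τ : ℝ}
    {U Y A B₁ B₂ G dU₁ dU₂ dY₁ dY₂ : ℕ → Ω → ℝ}
    (hκ : Tendsto κ atTop (nhds 1)) (hr : Tendsto r atTop (nhds 0))
    (hη : IsBoundedInProb P (fun n _ => η n))
    (hU : IsBoundedInProb P U) (hY : IsBoundedInProb P Y) (hA : IsBoundedInProb P A)
    (hB₁ : IsBoundedInProb P B₁) (hB₂ : IsBoundedInProb P B₂) (hG : IsBoundedInProb P G)
    (hdU₁ : IsBoundedInProb P dU₁) (hdU₂ : IsBoundedInProb P dU₂)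
    (hdY₁ : IsBoundedInProb P dY₁) (hdY₂ : IsBoundedInProb P dY₂) :
    IsNegligibleInProb P (fun n ω => (κ n - 1) * A n ω + r n * ((κ n *
        ((1 + r n * U n ω - r n ^ 2 * Y n ω ^ 2) *
        ((2 * r n * Y n ω * dY₁ n ω - dU₁ n ω - τ * r n * (2 * r n * Y n ω ^ 2 - U n ω))
          + (2 * r n * Y n ω * dY₂ n ω - dU₂ n ω - τ * r n * (2 * r n * Y n ω ^ 2 - U n ω)))
        + ((2 * r n * Y n ω ^ 2 - U n ω) * (2 * U n ω - r n * (dU₁ n ω + dU₂ n ω))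
          - 2 * Y n ω * (B₁ n ω + B₂ n ω) + 4 * r n * Y n ω ^ 2 * G n ω
          - 2 * r n * Y n ω * (2 * r n * Y n ω ^ 2 - U n ω)
            * (2 * Y n ω - r n * dY₁ n ω - r n * dY₂ n ω)))
        + (2 * r n * Y n ω ^ 2 - U n ω) ^ 2)
        + η n * (1 + r n * U n ω - r n ^ 2 * Y n ω ^ 2) ^ 2)) := by
  have hκB : IsBoundedInProb P (fun n _ => κ n) := isBoundedInProb_of_tendsto hκ
  have hrB : IsBoundedInProb P (fun n _ => r n) := isBoundedInProb_of_tendsto hr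
  have hκ1 : IsNegligibleInProb P (fun n _ => κ n - 1) :=
    .of_tendsto (by simpa using hκ.sub_const 1)
  have h2r := (IsBoundedInProb.const (P := P) 2).mul hrB
  have hb := (h2r.mul (hY.pow 2)).sub hU
  have hc := ((IsBoundedInProb.const (P := P) 1).add (hrB.mul hU)).sub ((hrB.pow 2).mul (hY.pow 2))
  have hτb := ((IsBoundedInProb.const (P := P) τ).mul hrB).mul hb
  have h₁ := (((h2r.mul hY).mul hdY₁).sub hdU₁).sub hτb
  have h₂ := (((h2r.mul hY).mul hdY₂).sub hdU₂).sub hτb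
  have h₃ := hb.mul (((IsBoundedInProb.const (P := P) 2).mul hU).sub (hrB.mul (hdU₁.add hdU₂)))
  have h₄ := ((IsBoundedInProb.const (P := P) 2).mul hY).mul (hB₁.add hB₂)
  have h₅ := (((IsBoundedInProb.const (P := P) 4).mul hrB).mul (hY.pow 2)).mul hG
  have h₆ := ((h2r.mul hY).mul hb).mul
    ((((IsBoundedInProb.const (P := P) 2).mul hY).sub (hrB.mul hdY₁)).sub (hrB.mul hdY₂))
  exact (hκ1.mul hA).add ((IsNegligibleInProb.of_tendsto hr).mul
    (((hκB.mul ((hc.mul (h₁.add h₂)).add (((h₃.sub h₄).add h₅).sub h₆))).add (hb.pow 2)).add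
      (hη.mul (hc.pow 2))))

end Negligible

/-! ### Reduction of the lagged moments to lagged products. -/

section Statistic

variable {Ω : Type*} [MeasurableSpace Ω] {P : Measure Ω}
  {y : ℕ → Ω → ℝ}

lemma isOrthogonalBounded_self (hy : iIndepFun y P)
    (hlaw : ∀ t, HasLaw (y t) (gaussianReal 0 1) P) :
    IsOrthogonalBounded P y (∫ x, x ^ 2 ∂(gaussianReal 0 1)) :=
  isOrthogonalBounded_comp hy hlaw (f := fun x => x) measurable_id (integrable_pow_gaussianReal 2)
    integral_id_gaussianReal

lemma isOrthogonalBounded_centeredSq (hy : iIndepFun y P)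
    (hlaw : ∀ t, HasLaw (y t) (gaussianReal 0 1) P) :
    IsOrthogonalBounded P (fun t ω => centeredSq (y t ω))
      (∫ x, centeredSq x ^ 2 ∂(gaussianReal 0 1)) :=
  isOrthogonalBounded_comp hy hlaw measurable_centeredSq (integrable_centeredSq_pow 2)
    integral_centeredSq

lemma isOrthogonalBounded_centeredSq_mul_centeredSq (hy : iIndepFun y P)
    (hlaw : ∀ t, HasLaw (y t) (gaussianReal 0 1) P) {τ : ℕ} (hτ : 1 ≤ τ) :
    IsOrthogonalBounded P (fun t ω => centeredSq (y t ω) * centeredSq (y (t + τ) ω))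
      ((∫ x, centeredSq x ^ 2 ∂(gaussianReal 0 1)) *
        ∫ x, centeredSq x ^ 2 ∂(gaussianReal 0 1)) :=
  isOrthogonalBounded_comp_mul_comp hy hlaw measurable_centeredSq measurable_centeredSq
    (integrable_centeredSq_pow 4) (integrable_centeredSq_pow 4) integral_centeredSq hτ

lemma sampleMean_eq {n : ℕ} (x : ℕ → ℝ) :
    sampleMean n x = (√(n : ℝ))⁻¹ * ((√(n : ℝ))⁻¹ * ∑ t ∈ Finset.range n, x t) := by
  rw [sampleMean, ← mul_assoc, ← sq, inv_pow, Real.sq_sqrt (Nat.cast_nonneg n)]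
  ring

lemma sampleVar_eq {d n : ℕ} (hn : 1 ≤ n) (x : ℕ → ℝ) :
    sampleVar d n x = (1 + (√(n : ℝ))⁻¹ * ((√(n : ℝ))⁻¹ * ∑ t ∈ Finset.range n, centeredSq (x t))
      - (√(n : ℝ))⁻¹ ^ 2 * ((√(n : ℝ))⁻¹ * ∑ t ∈ Finset.range n, x t) ^ 2)
        * ((n : ℝ) / ((n : ℝ) - d)) := by
  have hn0 : (0 : ℝ) < n := by exact_mod_cast hn
  have hr : (√(n : ℝ))⁻¹ ^ 2 = (n : ℝ)⁻¹ := by rw [inv_pow, Real.sq_sqrt hn0.le]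
  rw [sampleVar, sum_sq_sub_eq, sampleMean, mul_pow, ← mul_assoc, ← sq, hr]
  rw [← mul_div_assoc]
  field_simp
  ring

/-- The sample variance of standard normal observations converges to one in probability. -/
lemma isNegligibleInProb_sampleVar_sub_one [IsProbabilityMeasure P] (hy : iIndepFun y P)
    (hlaw : ∀ t, HasLaw (y t) (gaussianReal 0 1) P) (d : ℕ) :
    IsNegligibleInProb P (fun n ω => sampleVar d n (fun t => y t ω) - 1) := by
  have hU := (isOrthogonalBounded_centeredSq hy hlaw).isBoundedInProb_inv_sqrt_mul_sum
    (I := Finset.range) (by simp)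
  have hY := (isOrthogonalBounded_self hy hlaw).isBoundedInProb_inv_sqrt_mul_sum
    (I := Finset.range) (by simp)
  have hr := IsNegligibleInProb.of_tendsto (P := P) tendsto_inv_sqrt_natCast
  have hρ := tendsto_natCast_div_sub_natCast d
  have hρ1 : IsNegligibleInProb P (fun n _ => (n : ℝ) / ((n : ℝ) - d) - 1) :=
    .of_tendsto (by simpa using hρ.sub_const 1)
  refine (((hr.mul (hU.sub (hr.isBoundedInProb.mul (hY.pow 2)))).mul
    (isBoundedInProb_of_tendsto hρ)).add hρ1).congr ?_
  filter_upwards [eventually_ge_atTop 1] with n hn ω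
  rw [sampleVar_eq hn]
  ring

/-- Centring at the squared sample variance rather than at 1 is essential: the leading fluctuation
2U of the lagged moment is cancelled by that of the squared variance. -/
lemma isNegligibleInProb_lagged_moment [IsProbabilityMeasure P] (hy : iIndepFun y P)
    (hlaw : ∀ t, HasLaw (y t) (gaussianReal 0 1) P) {d : ℕ} (hd : d = 0 ∨ d = 1) {τ : ℕ}
    (hτ : 1 ≤ τ) :
    IsNegligibleInProb P (fun n ω => √(n : ℝ) *
      ((∑ t ∈ Finset.range (n - τ), (y t ω - sampleMean n fun t => y t ω) ^ 2 *
        (y (t + τ) ω - sampleMean n fun t => y t ω) ^ 2) / ((n : ℝ) - τ)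
          - sampleVar d n (fun t => y t ω) ^ 2)
      - (√(n : ℝ))⁻¹ * ∑ t ∈ Finset.range (n - τ),
        centeredSq (y t ω) * centeredSq (y (t + τ) ω)) := by
  have hu := isOrthogonalBounded_centeredSq hy hlaw
  have hs := isOrthogonalBounded_self hy hlaw
  have hid : Measurable (fun x : ℝ => x) := measurable_id
  have hcard : ∀ n, (Finset.range (n - τ)).card ≤ n := fun n => by simp
  have hU := hu.isBoundedInProb_inv_sqrt_mul_sum (I := Finset.range) (by simp)
  have hY := hs.isBoundedInProb_inv_sqrt_mul_sum (I := Finset.range) (by simp)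
  have hA := (isOrthogonalBounded_centeredSq_mul_centeredSq hy hlaw hτ
    ).isBoundedInProb_inv_sqrt_mul_sum hcard
  have hB₁ := (isOrthogonalBounded_comp_mul_comp hy hlaw measurable_centeredSq hid
    (integrable_centeredSq_pow 4) (integrable_pow_gaussianReal 4) integral_id_gaussianReal hτ
    ).isBoundedInProb_inv_sqrt_mul_sum hcard
  have hB₂ := (isOrthogonalBounded_comp_mul_comp hy hlaw hid measurable_centeredSq
    (integrable_pow_gaussianReal 4) (integrable_centeredSq_pow 4) integral_centeredSq hτ
    ).isBoundedInProb_inv_sqrt_mul_sum hcard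
  have hG := (isOrthogonalBounded_comp_mul_comp hy hlaw hid hid
    (integrable_pow_gaussianReal 4) (integrable_pow_gaussianReal 4) integral_id_gaussianReal hτ
    ).isBoundedInProb_inv_sqrt_mul_sum hcard
  have hIco : ∀ n, (Finset.Ico (n - τ) n).card ≤ τ := fun n => by simp; omega
  have hdU₁ := hu.isBoundedInProb_sum hIco
  have hdU₂ := hu.isBoundedInProb_sum (I := fun _ => Finset.range τ) (K := τ) (by simp)
  have hdY₁ := hs.isBoundedInProb_sum hIco
  have hdY₂ := hs.isBoundedInProb_sum (I := fun _ => Finset.range τ) (K := τ) (by simp)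
  have hη : IsBoundedInProb P (fun n _ => (n : ℝ) * (1 - ((n : ℝ) / ((n : ℝ) - d)) ^ 2)) :=
    IsBoundedInProb.of_abs_le (K := 8)
      ((eventually_ge_atTop 2).mono fun n hn => abs_mul_one_sub_sq_le hd hn)
  refine (isNegligibleInProb_expansion_remainder (τ := τ) (tendsto_natCast_div_sub_natCast τ)
    tendsto_inv_sqrt_natCast hη hU hY hA hB₁ hB₂ hG hdU₁ hdU₂ hdY₁ hdY₂).congr ?_
  filter_upwards [eventually_ge_atTop (τ + 2)] with n hn ω
  have hn0 : (0 : ℝ) < n := by exact_mod_cast (by omega)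
  have hr : (√(n : ℝ))⁻¹ ≠ 0 := by positivity
  have hcast : ((n - τ : ℕ) : ℝ) = (n : ℝ) - τ := Nat.cast_sub (by omega)
  have hN : (n : ℝ) - τ ≠ 0 := by
    rw [← hcast]; exact_mod_cast (by omega)
  have hsq : (√(n : ℝ))⁻¹⁻¹ ^ 2 = (n : ℝ) := by rw [inv_inv, Real.sq_sqrt hn0.le]
  have key := lagged_moment_expansion (r := (√(n : ℝ))⁻¹) (N := (n : ℝ) - τ)
    (U := (√(n : ℝ))⁻¹ * ∑ t ∈ Finset.range n, centeredSq (y t ω))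
    (Y := (√(n : ℝ))⁻¹ * ∑ t ∈ Finset.range n, y t ω)
    (A := (√(n : ℝ))⁻¹ * ∑ t ∈ Finset.range (n - τ), centeredSq (y t ω) * centeredSq (y (t + τ) ω))
    (B₁ := (√(n : ℝ))⁻¹ * ∑ t ∈ Finset.range (n - τ), centeredSq (y t ω) * y (t + τ) ω)
    (B₂ := (√(n : ℝ))⁻¹ * ∑ t ∈ Finset.range (n - τ), y t ω * centeredSq (y (t + τ) ω))
    (G := (√(n : ℝ))⁻¹ * ∑ t ∈ Finset.range (n - τ), y t ω * y (t + τ) ω)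
    (dU₁ := ∑ t ∈ Finset.Ico (n - τ) n, centeredSq (y t ω))
    (dU₂ := ∑ t ∈ Finset.range τ, centeredSq (y t ω))
    (dY₁ := ∑ t ∈ Finset.Ico (n - τ) n, y t ω)
    (dY₂ := ∑ t ∈ Finset.range τ, y t ω) hr hN
  simp only [mul_div_cancel_left₀ _ hr, hsq, sub_sub_cancel] at key
  -- Read backwards: full sums minus end terms become sums over windows of length n - τ, and the
  -- expansion folds back into products of squared deviations.
  rw [← sum_range_sub_eq_sub_Ico, ← sum_range_sub_eq_sub_Ico,
    ← sum_range_sub_shift_eq_sub_range (fun t => centeredSq (y t ω)) (by omega),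
    ← sum_range_sub_shift_eq_sub_range (fun t => y t ω) (by omega),
    ← sampleMean_eq (fun t => y t ω), ← hcast,
    ← sum_sq_sub_mul_sq_sub_eq (fun t => y t ω), hcast, inv_inv] at key
  rw [sampleVar_eq (by omega)]
  have hsn : √(n : ℝ) = (√(n : ℝ))⁻¹ * n := by
    field_simp
    exact Real.sq_sqrt hn0.le
  -- Isolates the divisor: replacing c by cρ adds √n(1 - ρ²)c², which is r times a bounded quantity.
  have split : ∀ C c ρ : ℝ, √(n : ℝ) * (C - (c * ρ) ^ 2)
      = √(n : ℝ) * (C - c ^ 2) + (√(n : ℝ))⁻¹ * (n * (1 - ρ ^ 2) * c ^ 2) := fun C c ρ => by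
    have : √(n : ℝ) * (C - (c * ρ) ^ 2)
      = √(n : ℝ) * (C - c ^ 2) + √(n : ℝ) * ((1 - ρ ^ 2) * c ^ 2) := by ring
    rw [this]
    nth_rewrite 2 [hsn]
    ring
  rw [split, key]
  ring

end Statistic

/-! ### Slutsky steps and the limit law. -/

section Limit

variable {Ω : Type*} [MeasurableSpace Ω] {P : Measure Ω} [IsProbabilityMeasure P]
  {y : ℕ → Ω → ℝ}

/-- For a moment S, a lagged sum A and w the inverse squared variance, √n(Sw - 1) - A = (√n(S - w⁻¹)
- A)w + (w - 1)A wherever the variance is nonzero. -/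
lemma isNegligibleInProb_standardized_moment (hy : iIndepFun y P)
    (hlaw : ∀ t, HasLaw (y t) (gaussianReal 0 1) P) {d : ℕ} (hd : d = 0 ∨ d = 1) {τ : ℕ}
    (hτ : 1 ≤ τ) :
    IsNegligibleInProb P (fun n ω => √(n : ℝ) *
      ((∑ t ∈ Finset.range (n - τ), standardized d n (fun t => y t ω) t ^ 2 *
        standardized d n (fun t => y t ω) (t + τ) ^ 2) / ((n : ℝ) - τ) - 1)
      - (√(n : ℝ))⁻¹ * ∑ t ∈ Finset.range (n - τ),
        centeredSq (y t ω) * centeredSq (y (t + τ) ω)) := by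
  have hc := isNegligibleInProb_sampleVar_sub_one hy hlaw d
  have hw : IsNegligibleInProb P
      (fun n ω => (sampleVar d n (fun t => y t ω) ^ 2)⁻¹ - 1) := by
    have hg : ContinuousAt (fun c : ℝ => (c ^ 2)⁻¹) 1 :=
      (continuousAt_id.pow 2).inv₀ (by simp)
    simpa using hc.comp_continuousAt hg
  have hN := isNegligibleInProb_lagged_moment hy hlaw hd hτ
  have hA := (isOrthogonalBounded_centeredSq_mul_centeredSq hy hlaw hτ
    ).isBoundedInProb_inv_sqrt_mul_sum (I := fun n => Finset.range (n - τ)) (fun n => by simp)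
  -- Accounts for zero sample variance, where the inverse is 0 by convention. The term vanishes
  -- unless the variance is at distance at least 1 from 1, an event of vanishing probability.
  have hjunk : IsNegligibleInProb P (fun n ω => √(n : ℝ) * (sampleVar d n (fun t => y t ω) ^ 2 *
      (sampleVar d n (fun t => y t ω) ^ 2)⁻¹ - 1)) := by
    refine hc.of_eq_zero_of_abs_lt one_pos fun n ω h => ?_
    have h0 : sampleVar d n (fun t => y t ω) ≠ 0 := fun h0 => by simp [h0] at h
    rw [mul_inv_cancel₀ (pow_ne_zero 2 h0), sub_self, mul_zero]
  refine (((hN.mul (hw.isBoundedInProb.add (IsBoundedInProb.const 1))).add (hw.mul hA)).add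
    hjunk).congr ?_
  filter_upwards [eventually_ge_atTop 1] with n hn ω
  have hz : ∑ t ∈ Finset.range (n - τ), standardized d n (fun t => y t ω) t ^ 2 *
      standardized d n (fun t => y t ω) (t + τ) ^ 2 =
      (∑ t ∈ Finset.range (n - τ), (y t ω - sampleMean n fun t => y t ω) ^ 2 *
        (y (t + τ) ω - sampleMean n fun t => y t ω) ^ 2)
          * (sampleVar d n (fun t => y t ω) ^ 2)⁻¹ := by
    rw [Finset.sum_mul]
    refine Finset.sum_congr rfl fun t _ => ?_
    rw [standardized_sq (by omega), standardized_sq (by omega), div_mul_div_comm, ← sq,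
      div_eq_mul_inv]
  rw [hz]
  ring

/-- Moving the window of summation by a fixed amount changes the normalized sum negligibly. -/
lemma isNegligibleInProb_shifted_sum {ξ : ℕ → Ω → ℝ} {C : ℝ} (h : IsOrthogonalBounded P ξ C)
    {M τ : ℕ} (hτM : τ ≤ M) :
    IsNegligibleInProb P (fun n ω => (√(n : ℝ))⁻¹ * ∑ t ∈ Finset.range (n - τ), ξ t ω
      - (√(n : ℝ))⁻¹ * ∑ t ∈ Finset.range n, ξ (t + M - τ) ω) := by
  have h1 := h.isBoundedInProb_sum (I := fun _ => Finset.range (M - τ)) (K := M) (by simp)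
  have h2 := h.isBoundedInProb_sum (I := fun n => Finset.Ico (n - τ) (n + (M - τ))) (K := M)
    (fun n => by simp; omega)
  refine ((IsNegligibleInProb.of_tendsto tendsto_inv_sqrt_natCast).mul (h1.sub h2)).congr
    (Eventually.of_forall fun n ω => ?_)
  have e1 : ∑ t ∈ Finset.range n, ξ (t + M - τ) ω
      = ∑ t ∈ Finset.range (n + (M - τ)), ξ t ω - ∑ t ∈ Finset.range (M - τ), ξ t ω := by
    rw [add_comm n, Finset.sum_range_add, add_sub_cancel_left]
    refine Finset.sum_congr rfl fun t _ => ?_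
    rw [Nat.add_sub_assoc hτM, add_comm]
  rw [e1, ← Finset.sum_range_add_sum_Ico (fun t => ξ t ω)
    (show n - τ ≤ n + (M - τ) by omega)]
  ring

lemma isNegligibleInProb_volatilityStat_sub (hy : iIndepFun y P)
    (hlaw : ∀ t, HasLaw (y t) (gaussianReal 0 1) P) {d : ℕ} (hd : d = 0 ∨ d = 1)
    {T : Finset ℕ} (hT : ∀ τ ∈ T, 1 ≤ τ) {M : ℕ} (hM : ∀ τ ∈ T, τ ≤ M) :
    IsNegligibleInProb P (fun n ω => volatilityStat d T n (fun t => y t ω)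
      - ∑ τ ∈ T, ((√(n : ℝ))⁻¹ * (∑ t ∈ Finset.range n,
        centeredSq (y (t + M - τ) ω) * centeredSq (y (t + M) ω)) / 2) ^ 2) := by
  have main : ∀ τ ∈ T, IsNegligibleInProb P (fun n ω =>
      (√(n : ℝ) * ((∑ t ∈ Finset.range (n - τ), standardized d n (fun t => y t ω) t ^ 2 *
        standardized d n (fun t => y t ω) (t + τ) ^ 2) / ((n : ℝ) - τ) - 1)) ^ 2 / 4
      - ((√(n : ℝ))⁻¹ * (∑ t ∈ Finset.range n,
        centeredSq (y (t + M - τ) ω) * centeredSq (y (t + M) ω)) / 2) ^ 2) := by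
    intro τ hτ
    have hζ := isOrthogonalBounded_centeredSq_mul_centeredSq hy hlaw (hT τ hτ)
    have hV := isNegligibleInProb_standardized_moment hy hlaw hd (hT τ hτ)
    have hA := hζ.isBoundedInProb_inv_sqrt_mul_sum (I := fun n => Finset.range (n - τ))
      (fun n => by simp)
    have hS := isNegligibleInProb_shifted_sum hζ (hM τ hτ)
    have hdiff := hV.add hS
    have hA' := hA.sub hS.isBoundedInProb
    -- Writes a² - b² as (a - b)((a - b) + 2b), where b is the shifted sum, bounded by `hA'`, and a
    -- - b is the negligible `hdiff`.
    refine (hdiff.mul ((hdiff.isBoundedInProb.add (hA'.mul (IsBoundedInProb.const 2))).mul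
      (IsBoundedInProb.const (1 / 4)))).congr (Eventually.of_forall fun n ω => ?_)
    have hidx : ∀ t, t + M - τ + τ = t + M := fun t => by have := hM τ hτ; omega
    simp only [hidx]
    ring
  refine (IsNegligibleInProb.sum main).congr (Eventually.of_forall fun n ω => ?_)
  rw [Finset.sum_sub_distrib, volatilityStat, Finset.mul_sum]
  congr 1
  refine Finset.sum_congr rfl fun τ _ => ?_
  rw [mul_pow, Real.sq_sqrt (Nat.cast_nonneg n)]
  ring

/-- The asymptotic chi-squared law for the sums of lagged products, indexed by the lags. -/
theorem tendstoInDistribution_sum_sq_finset (hy : iIndepFun y P)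
    (hlaw : ∀ t, HasLaw (y t) (gaussianReal 0 1) P) {T : Finset ℕ} (hT : ∀ τ ∈ T, 1 ≤ τ)
    {M : ℕ} (hM : ∀ τ ∈ T, τ ≤ M) :
    TendstoInDistribution (fun (n : ℕ) ω => ∑ τ ∈ T, ((√(n : ℝ))⁻¹ * (∑ t ∈ Finset.range n,
        centeredSq (y (t + M - τ) ω) * centeredSq (y (t + M) ω)) / 2) ^ 2) atTop
      (id : ℝ → ℝ) (fun _ => P) (chiSquared T.card) := by
  have h := tendstoInDistribution_sum_sq_laggedProduct (M := M)
    (τ := fun i : Fin T.card => (T.equivFin.symm i : ℕ)) hy hlaw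
    (Subtype.val_injective.comp T.equivFin.symm.injective)
    (fun i => hT _ (T.equivFin.symm i).2) (fun i => hM _ (T.equivFin.symm i).2)
  refine h.congr (fun n => ae_of_all _ fun ω => ?_) (ae_of_all _ fun _ => rfl)
  simp only
  rw [← Finset.sum_coe_sort T]
  exact T.equivFin.symm.sum_comp (fun τ : T => ((√(n : ℝ))⁻¹ * (∑ t ∈ Finset.range n,
    centeredSq (y (t + M - τ) ω) * centeredSq (y (t + M) ω)) / 2) ^ 2)

end Limit

theorem theorem3 {Ω : Type*} [MeasurableSpace Ω] (P : Measure Ω) [IsProbabilityMeasure P]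
    (x : ℕ → Ω → ℝ) (m : ℝ) (v : NNReal) (hv : v ≠ 0)
    (hindep : iIndepFun x P) (hlaw : ∀ t, HasLaw (x t) (gaussianReal m v) P)
    (T : Finset ℕ) (hT : ∀ τ ∈ T, 1 ≤ τ) (d : ℕ) (hd : d = 0 ∨ d = 1) :
    TendstoInDistribution (fun (n : ℕ) (ω : Ω) => volatilityStat d T n (fun t => x t ω)) atTop
      (id : ℝ → ℝ) (fun _ => P) (chiSquared T.card) := by
  have hs : 0 < √(v : ℝ) := Real.sqrt_pos.2 (by exact_mod_cast pos_iff_ne_zero.2 hv)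
  set y : ℕ → Ω → ℝ := fun t ω => (x t ω - m) / √(v : ℝ) with hydef
  have hy : iIndepFun y P :=
    hindep.comp (fun _ a => (a - m) / √(v : ℝ)) (fun _ => by fun_prop)
  have hylaw : ∀ t, HasLaw (y t) (gaussianReal 0 1) P := fun t => by
    have h := gaussianReal_div_const (gaussianReal_sub_const (hlaw t) m) √(v : ℝ)
    convert! h using 2
    · simp
    · rw [eq_comm, div_eq_one_iff_eq]
      · ext
        simp
      · intro h0
        have := congrArg NNReal.toReal h0
        simp at this
        exact hv this
  have hxy : ∀ ω t, x t ω = m + √(v : ℝ) * y t ω := fun ω t => by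
    simp only [hydef]
    field_simp
    ring
  -- The largest lag serves as the common shift M, with value 0 if there are no lags.
  have hM : ∀ τ ∈ T, τ ≤ T.sup id := fun τ hτ => Finset.le_sup (f := id) hτ
  refine tendstoInDistribution_of_tendstoInMeasure_sub _ _
    (tendstoInDistribution_sum_sq_finset hy hylaw hT hM) ?_ fun n =>
      (measurable_volatilityStat d T n).comp_aemeasurable
        (aemeasurable_pi_iff.2 fun t => (hlaw t).aemeasurable)
  refine IsNegligibleInProb.tendstoInMeasure
    ((isNegligibleInProb_volatilityStat_sub hy hylaw hd hT hM).congr ?_)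
  filter_upwards [eventually_ge_atTop 1] with n hn ω
  have hst : standardized d n (fun t => x t ω) = standardized d n (fun t => y t ω) :=
    standardized_affine hn hs (hxy ω)
  simp only [Pi.sub_apply, volatilityStat, hst]
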